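/- A dagger category is a category with an identity-on-objects, involutive, contravariant operation $f \mapsto f^\dagger$ on morphisms; a dagger isomorphism is an isomorphism $f$ with $f^{-1} = f^\dagger$. A dagger symmetric monoidal category is a dagger category with a symmetric monoidal structure such that $(f \otimes g)^\dagger = f^\dagger \otimes g^\dagger$ and the associators, unitors and braidings $\beta$ are dagger isomorphisms. It is dagger compact closed if for each object $X$ there are an object $X^*$ and a morphism $\eta_X : I \to X^* \otimes X$ such that $\eta_X$ and $\eta_X^\dagger \circ \beta_{X, X^*} : X \otimes X^* \to I$ are the unit and the counit of a duality, i.e., satisfy the triangle identities. A dagger biproduct of a family $(X_m)_{m \in M}$ is an object $\bigoplus_m X_m$ with morphisms $\mathrm{inc}_m : X_m \to \bigoplus_m X_m$ that make it a coproduct, whose daggers make it a product, and which satisfy $\mathrm{inc}_m^\dagger \circ \mathrm{inc}_m = \mathrm{id}$ and $\mathrm{inc}_m^\dagger \circ \mathrm{inc}_n = 0$ for $m \neq n$. Let $(\mathbf{C}, \otimes, I, \dagger)$ be a (locally small) dagger compact closed category such that (1') each (small) family of objects has a dagger biproduct (in particular there is a zero object); (2') $I$ is simple (a monomorphism into $I$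 is an isomorphism if and only if it is nonzero) and separating (the morphisms $I \to X$ are jointly epic for every object $X$); (3') each object $X$ has a unique morphism $\top_X : I \to X$ with $\mathrm{coker}(\top_X) = 0$; (4') for each morphism $a : I \to X$ there are objects $A$, $B$ and a dagger isomorphism $i : A \oplus B \to X$ such that $a = i \circ \mathrm{inc}_1 \circ \top_A$. For parallel morphisms $r, s : X \to Y$ let $r + s = \Delta_Y^\dagger \circ (r \oplus s) \circ \Delta_X$, where $\Delta_X : X \to X \oplus X$ is the diagonal, and write $r \leq s$ if $r + s = s$. For each object $X$, let $E(X)$ be the set of atoms of $\mathbf{C}(I, X)$, i.e., of nonzero $x : I \to X$ such that $y \le x$ implies $y = 0$ or $y = x$; for each morphism $r : X \to Y$, let $E(r) = \{(x, y) \in E(X) \times E(Y) \mid y^\dagger \circ r \circ x = \mathrm{id}_I\}$. Then $E$ is a strong symmetric monoidal dagger equivalence from $(\mathbf{C}, \otimes, I, \dagger)$ to the category $(\mathbf{Rel}, \times, \{\ast\}, \dagger)$ of sets and binary relations, with the converse of a relation as its dagger. That is: $E$ is a functor; $E(r^\dagger) = E(r)^\dagger$ for all $r$; $E$ is full and faithful;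 every set is dagger isomorphic to $E(X)$ for some object $X$; and $E$ is a strong symmetric monoidal functor whose structure morphisms, which are dagger isomorphisms, are the functions $\{\ast\} \to E(I)$, $\ast \mapsto \mathrm{id}_I$, and $E(X) \times E(Y) \to E(X \otimes Y)$, $(x, y) \mapsto x \otimes y$ (where $x \otimes y$ is precomposed with the unitor $I \cong I \otimes I$). Conversely, $(\mathbf{Rel}, \times, \{\ast\}, \dagger)$ is a dagger compact closed category that satisfies (1')-(4'). -/

import Mathlib

open CategoryTheory MonoidalCategory Limits

universe v u

/-! ## Dagger categories -/

/-- A dagger category: a category with an involutive, identity-on-objects, contravariant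
operation on morphisms. -/
class DaggerCategory (C : Type u) [Category.{v} C] where
  dag : ∀ {X Y : C}, (X ⟶ Y) → (Y ⟶ X)
  dag_id : ∀ X : C, dag (𝟙 X) = 𝟙 X
  dag_dag : ∀ {X Y : C} (f : X ⟶ Y), dag (dag f) = f
  dag_comp : ∀ {X Y Z : C} (f : X ⟶ Y) (g : Y ⟶ Z), dag (f ≫ g) = dag g ≫ dag f

open DaggerCategory (dag)

section Dagger

variable {C : Type u} [Category.{v} C] [DaggerCategory C]

/-- A dagger isomorphism: a morphism whose dagger is a two-sided inverse. -/
def IsDaggerIso {X Y : C} (f : X ⟶ Y) : Prop :=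
  f ≫ dag f = 𝟙 X ∧ dag f ≫ f = 𝟙 Y

/-- A dagger biproduct of a family of objects: an object that is a coproduct via the injections
and a product via their daggers, the injections being dagger monic and pairwise orthogonal. -/
structure DaggerBiproduct [HasZeroMorphisms C] {M : Type v} (X : M → C) where
  pt : C
  inj : ∀ m, X m ⟶ pt
  isColimit : IsColimit (Cofan.mk pt inj)
  isLimit : IsLimit (Fan.mk pt (fun m => dag (inj m)))
  inj_dag_self : ∀ m, inj m ≫ dag (inj m) = 𝟙 (X m)
  inj_dag_of_ne : ∀ m n, m ≠ n → inj m ≫ dag (inj n) = 0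

/-- The two-membered family `A, B`, indexed by `false, true`. -/
def pairFamily (A B : C) : ULift.{v} Bool → C :=
  fun b => match b with
    | ⟨false⟩ => A
    | ⟨true⟩ => B

/-- A dagger biproduct `A ⊕ B` of two objects. -/
abbrev BinaryDaggerBiproduct [HasZeroMorphisms C] (A B : C) :=
  DaggerBiproduct (pairFamily A B)

/-- The first inclusion `A ⟶ A ⊕ B`. -/
def BinaryDaggerBiproduct.inc₁ [HasZeroMorphisms C] {A B : C} (P : BinaryDaggerBiproduct A B) :
    A ⟶ P.pt :=
  P.inj ⟨false⟩

/-- The second inclusion `B ⟶ A ⊕ B`. -/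
def BinaryDaggerBiproduct.inc₂ [HasZeroMorphisms C] {A B : C} (P : BinaryDaggerBiproduct A B) :
    B ⟶ P.pt :=
  P.inj ⟨true⟩

end Dagger

/-- Every (small) family of objects has a dagger biproduct. -/
class HasDaggerBiproducts (C : Type u) [Category.{v} C] [DaggerCategory C]
    [HasZeroMorphisms C] : Prop where
  exists_biproduct : ∀ {M : Type v} (X : M → C), Nonempty (DaggerBiproduct X)

section Sums

variable {C : Type u} [Category.{v} C] [DaggerCategory C] [HasZeroMorphisms C]

/-- The diagonal `X ⟶ ⨁ X` into a biproduct of copies of `X`. -/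
def DaggerBiproduct.diag {M : Type v} {X : C} (P : DaggerBiproduct (fun _ : M => X)) :
    X ⟶ P.pt :=
  Fan.IsLimit.lift P.isLimit (fun _ => 𝟙 X)

/-- The morphism `⨁ rₘ` between biproducts induced by a family of morphisms. -/
def DaggerBiproduct.map {M : Type v} {X Y : M → C} (P : DaggerBiproduct X)
    (Q : DaggerBiproduct Y) (r : ∀ m, X m ⟶ Y m) : P.pt ⟶ Q.pt :=
  Cofan.IsColimit.desc P.isColimit (fun m => r m ≫ Q.inj m)

variable [HasDaggerBiproducts C]

/-- A choice of dagger biproduct of a family. -/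
noncomputable def biprodOf {M : Type v} (X : M → C) : DaggerBiproduct X :=
  Classical.choice (HasDaggerBiproducts.exists_biproduct X)

/-- The sum of a family of parallel morphisms: the diagonal, followed by the biproduct of the
family, followed by the dagger of the diagonal. -/
noncomputable def homSum {M : Type v} {X Y : C} (r : M → (X ⟶ Y)) : X ⟶ Y :=
  (biprodOf (fun _ : M => X)).diag ≫
    DaggerBiproduct.map (biprodOf (fun _ : M => X)) (biprodOf (fun _ : M => Y)) r ≫
      dag (biprodOf (fun _ : M => Y)).diag

/-- The sum `r + s` of two parallel morphisms. -/
noncomputable def homAdd {X Y : C} (r s : X ⟶ Y) : X ⟶ Y :=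
  homSum (fun b : ULift.{v} Bool => match b with
    | ⟨false⟩ => r
    | ⟨true⟩ => s)

/-- The order on parallel morphisms: `r ≤ s` when `r + s = s`. -/
def HomLE {X Y : C} (r s : X ⟶ Y) : Prop :=
  homAdd r s = s

/-- A morphism is an atom of its hom-set when it is nonzero and the only morphisms below it are
`0` and itself. -/
def IsHomAtom {X Y : C} (x : X ⟶ Y) : Prop :=
  x ≠ 0 ∧ ∀ y : X ⟶ Y, HomLE y x → y = 0 ∨ y = x

end Sums

/-- A morphism has zero cokernel: some (equivalently, every) morphism to a zero object is a
cokernel of it. -/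
def HasZeroCokernel {C : Type u} [Category.{v} C] [HasZeroMorphisms C] {X Y : C}
    (f : X ⟶ Y) : Prop :=
  ∃ (Z : C) (q : Y ⟶ Z) (w : f ≫ q = 0), IsZero Z ∧ Nonempty (IsColimit (CokernelCofork.ofπ q w))

/-! ## Dagger compact closed categories -/

/-- A dagger symmetric monoidal category: the tensor product is a dagger functor and the
associators, unitors and braidings are dagger isomorphisms. -/
class DaggerSymmetricMonoidal (C : Type u) [Category.{v} C] [DaggerCategory C]
    [MonoidalCategory C] [SymmetricCategory C] : Prop where
  dag_tensor : ∀ {X₁ Y₁ X₂ Y₂ : C} (f : X₁ ⟶ Y₁) (g : X₂ ⟶ Y₂),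
    dag (f ⊗ₘ g) = dag f ⊗ₘ dag g
  associator_dag : ∀ X Y Z : C, IsDaggerIso (α_ X Y Z).hom
  leftUnitor_dag : ∀ X : C, IsDaggerIso (λ_ X).hom
  rightUnitor_dag : ∀ X : C, IsDaggerIso (ρ_ X).hom
  braiding_dag : ∀ X Y : C, IsDaggerIso (β_ X Y).hom

/-- `D` is a dagger dual of `X`: there are a coevaluation `η : I ⟶ D ⊗ X` and an evaluation
`X ⊗ D ⟶ I` that satisfy the triangle identities, the evaluation being the dagger of `η`
precomposed with the braiding. -/
def IsDaggerDual {C : Type u} [Category.{v} C] [DaggerCategory C]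
    [MonoidalCategory C] [SymmetricCategory C] (D X : C) : Prop :=
  ∃ p : ExactPairing D X, p.evaluation' = (β_ X D).hom ≫ dag p.coevaluation'

/-- A dagger compact closed category: a dagger symmetric monoidal category in which each object
has a dagger dual. -/
class DaggerCompactClosed (C : Type u) [Category.{v} C] [DaggerCategory C]
    [MonoidalCategory C] [SymmetricCategory C] : Prop extends DaggerSymmetricMonoidal C where
  exists_dual : ∀ X : C, ∃ D : C, IsDaggerDual D X

/-- Each morphism `a : I ⟶ X` factors as `⊤_A`, followed by the inclusion `A ⟶ A ⊕ B`, followed by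
a dagger isomorphism `A ⊕ B ⟶ X`. Here `⊤_A : I ⟶ A` denotes a morphism with zero cokernel. -/
def UnitMorphismsFactor (C : Type u) [Category.{v} C] [DaggerCategory C]
    [MonoidalCategory C] [HasZeroMorphisms C] : Prop :=
  ∀ (X : C) (a : 𝟙_ C ⟶ X), ∃ (A B : C) (P : BinaryDaggerBiproduct A B) (i : P.pt ⟶ X)
    (t : 𝟙_ C ⟶ A), IsDaggerIso i ∧ HasZeroCokernel t ∧ a = t ≫ P.inc₁ ≫ i

/-- A dagger equivalence: a full and faithful dagger functor such that every object of the target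
is dagger isomorphic to an object in the image. -/
structure IsDaggerEquivalence {C : Type*} {D : Type*} [Category C] [Category D]
    [DaggerCategory C] [DaggerCategory D] (F : C ⥤ D) : Prop where
  map_dag : ∀ {X Y : C} (f : X ⟶ Y), F.map (dag f) = dag (F.map f)
  full : F.Full
  faithful : F.Faithful
  surj : ∀ S : D, ∃ (X : C) (i : F.obj X ⟶ S), IsDaggerIso i

/-! ## The dagger symmetric monoidal category of sets and relations -/

namespace RelSets

/-- The underlying type of an object of `RelCat`. -/
abbrev carrier (X : RelCat.{v}) : Type v := X

/-- The object of `RelCat` given by a type. -/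
abbrev of (X : Type v) : RelCat.{v} := X

/-- The morphism of `RelCat` given by a binary relation. -/
def mk {X Y : RelCat.{v}} (r : carrier X → carrier Y → Prop) : X ⟶ Y :=
  RelCat.Hom.ofRel (X := X) (Y := Y) {p | r p.1 p.2}

/-- The binary relation underlying a morphism of `RelCat`. -/
def rel {X Y : RelCat.{v}} (f : X ⟶ Y) (x : carrier X) (y : carrier Y) : Prop :=
  (x, y) ∈ RelCat.Hom.rel f

theorem hom_ext {X Y : RelCat.{v}} {f g : X ⟶ Y} (h : ∀ x y, rel f x y ↔ rel g x y) : f = g :=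
  RelCat.Hom.ext f g (Set.ext fun p => h p.1 p.2)

@[simp] theorem rel_mk {X Y : RelCat.{v}} (r : carrier X → carrier Y → Prop) (x : carrier X)
    (y : carrier Y) : rel (mk r) x y ↔ r x y := Iff.rfl

@[simp] theorem rel_id {X : RelCat.{v}} (x y : carrier X) : rel (𝟙 X) x y ↔ x = y := Iff.rfl

@[simp] theorem rel_comp {X Y Z : RelCat.{v}} (f : X ⟶ Y) (g : Y ⟶ Z) (x : carrier X)
    (z : carrier Z) : rel (f ≫ g) x z ↔ ∃ y, rel f x y ∧ rel g y z := Iff.rfl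

/-- The graph of a bijection, as an isomorphism of `RelCat`. -/
def isoOfEquiv {X Y : RelCat.{v}} (e : carrier X ≃ carrier Y) : X ≅ Y where
  hom := mk fun x y => e x = y
  inv := mk fun y x => e x = y
  hom_inv_id := hom_ext fun x y => by simp [eq_comm]
  inv_hom_id := hom_ext fun x y => by
    simp only [rel_comp, rel_mk, rel_id]
    exact ⟨fun ⟨z, h, h'⟩ => h.symm.trans h', fun h => ⟨e.symm x, by simp [h]⟩⟩

/-- The dagger of a relation is its converse. -/
instance : DaggerCategory RelCat.{v} where
  dag f := mk fun y x => rel f x y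
  dag_id X := hom_ext fun x y => by simp [eq_comm]
  dag_dag f := rfl
  dag_comp f g := hom_ext fun x y => by simp [and_comm]

/-- The zero morphisms of `RelCat` are the empty relations. -/
instance : HasZeroMorphisms RelCat.{v} where
  zero _ _ := ⟨mk fun _ _ => False⟩
  comp_zero _ _ := hom_ext fun _ _ => ⟨fun ⟨_, _, h⟩ => h, fun h => h.elim⟩
  zero_comp _ _ _ _ := hom_ext fun _ _ => ⟨fun ⟨_, h, _⟩ => h, fun h => h.elim⟩

/-- The monoidal structure: the cartesian product of sets, with a singleton as the unit, and with
the usual bijections as associators and unitors. -/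
instance : MonoidalCategoryStruct RelCat.{v} where
  tensorObj X Y := of (carrier X × carrier Y)
  tensorUnit := of PUnit.{v + 1}
  tensorHom {X₁ Y₁ X₂ Y₂} f g :=
    mk (X := of (carrier X₁ × carrier X₂)) (Y := of (carrier Y₁ × carrier Y₂))
      fun p q => rel f p.1 q.1 ∧ rel g p.2 q.2
  whiskerLeft X {Y₁ Y₂} g :=
    mk (X := of (carrier X × carrier Y₁)) (Y := of (carrier X × carrier Y₂))
      fun p q => p.1 = q.1 ∧ rel g p.2 q.2
  whiskerRight {X₁ X₂} f Y :=
    mk (X := of (carrier X₁ × carrier Y)) (Y := of (carrier X₂ × carrier Y))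
      fun p q => rel f p.1 q.1 ∧ p.2 = q.2
  associator X Y Z := isoOfEquiv (Equiv.prodAssoc (carrier X) (carrier Y) (carrier Z))
  leftUnitor X := isoOfEquiv (Equiv.punitProd (carrier X))
  rightUnitor X := isoOfEquiv (Equiv.prodPUnit (carrier X))

@[simp] theorem rel_dag {X Y : RelCat.{v}} (f : X ⟶ Y) (y : carrier Y) (x : carrier X) :
    rel (dag f) y x ↔ rel f x y := Iff.rfl

@[simp] theorem rel_tensor {X₁ Y₁ X₂ Y₂ : RelCat.{v}} (f : X₁ ⟶ Y₁) (g : X₂ ⟶ Y₂)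
    (p : carrier X₁ × carrier X₂) (q : carrier Y₁ × carrier Y₂) :
    rel (f ⊗ₘ g) p q ↔ rel f p.1 q.1 ∧ rel g p.2 q.2 := Iff.rfl

@[simp] theorem rel_whiskerLeft (X : RelCat.{v}) {Y₁ Y₂ : RelCat.{v}} (g : Y₁ ⟶ Y₂)
    (p : carrier X × carrier Y₁) (q : carrier X × carrier Y₂) :
    rel (X ◁ g) p q ↔ p.1 = q.1 ∧ rel g p.2 q.2 := Iff.rfl

@[simp] theorem rel_whiskerRight {X₁ X₂ : RelCat.{v}} (f : X₁ ⟶ X₂) (Y : RelCat.{v})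
    (p : carrier X₁ × carrier Y) (q : carrier X₂ × carrier Y) :
    rel (f ▷ Y) p q ↔ rel f p.1 q.1 ∧ p.2 = q.2 := Iff.rfl

@[simp] theorem rel_associator_hom (X Y Z : RelCat.{v})
    (p : (carrier X × carrier Y) × carrier Z) (q : carrier X × carrier Y × carrier Z) :
    rel (α_ X Y Z).hom p q ↔ (p.1.1, p.1.2, p.2) = q := Iff.rfl

@[simp] theorem rel_associator_inv (X Y Z : RelCat.{v})
    (p : (carrier X × carrier Y) × carrier Z) (q : carrier X × carrier Y × carrier Z) :
    rel (α_ X Y Z).inv q p ↔ (p.1.1, p.1.2, p.2) = q := Iff.rfl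

@[simp] theorem rel_leftUnitor_hom (X : RelCat.{v}) (p : PUnit.{v + 1} × carrier X)
    (x : carrier X) : rel (λ_ X).hom p x ↔ p.2 = x := Iff.rfl

@[simp] theorem rel_rightUnitor_hom (X : RelCat.{v}) (p : carrier X × PUnit.{v + 1})
    (x : carrier X) : rel (ρ_ X).hom p x ↔ p.1 = x := Iff.rfl

theorem exists_carrier_tensor {X Y : RelCat.{v}} {P : carrier (X ⊗ Y) → Prop} :
    (∃ p, P p) ↔ ∃ (x : carrier X) (y : carrier Y), P (x, y) := Prod.exists

instance : MonoidalCategory RelCat.{v} where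
  tensorHom_def f g := by
    refine hom_ext ?_
    rintro ⟨a, b⟩ ⟨c, d⟩
    simp [exists_carrier_tensor]
  id_tensorHom_id X Y := by
    refine hom_ext ?_
    rintro ⟨a, b⟩ ⟨c, d⟩
    simp only [rel_tensor, rel_id]
    exact Prod.mk_inj.symm
  tensorHom_comp_tensorHom f₁ f₂ g₁ g₂ := by
    refine hom_ext ?_
    rintro ⟨a, b⟩ ⟨c, d⟩
    simp [exists_carrier_tensor]
    grind
  whiskerLeft_id X Y := by
    refine hom_ext ?_
    rintro ⟨a, b⟩ ⟨c, d⟩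
    simp only [rel_whiskerLeft, rel_id]
    exact Prod.mk_inj.symm
  id_whiskerRight X Y := by
    refine hom_ext ?_
    rintro ⟨a, b⟩ ⟨c, d⟩
    simp only [rel_whiskerRight, rel_id]
    exact Prod.mk_inj.symm
  associator_naturality f g h := by
    refine hom_ext ?_
    rintro ⟨⟨a, b⟩, c⟩ ⟨d, e, e'⟩
    simp [exists_carrier_tensor, and_assoc]
  leftUnitor_naturality f := by
    refine hom_ext ?_
    rintro ⟨a, b⟩ c
    simp [exists_carrier_tensor]
  rightUnitor_naturality f := by
    refine hom_ext ?_
    rintro ⟨a, b⟩ c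
    simp [exists_carrier_tensor]
  pentagon W X Y Z := by
    refine hom_ext ?_
    rintro ⟨⟨⟨a, b⟩, c⟩, d⟩ ⟨a', b', c', d'⟩
    simp [exists_carrier_tensor]
    exact fun _ _ => Prod.mk_inj.symm
  triangle X Y := by
    refine hom_ext ?_
    rintro ⟨⟨a, b⟩, c⟩ ⟨d, e⟩
    simp

/-- The bijection `X × Y → Y × X` that swaps the factors. -/
def swapIso (X Y : RelCat.{v}) : X ⊗ Y ≅ Y ⊗ X :=
  isoOfEquiv (Equiv.prodComm (carrier X) (carrier Y))

@[simp] theorem rel_swapIso_hom (X Y : RelCat.{v}) (p : carrier X × carrier Y)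
    (q : carrier Y × carrier X) : rel (swapIso X Y).hom p q ↔ p.2 = q.1 ∧ p.1 = q.2 :=
  Prod.ext_iff (x := p.swap) (y := q)

@[simp] theorem rel_swapIso_inv (X Y : RelCat.{v}) (p : carrier X × carrier Y)
    (q : carrier Y × carrier X) : rel (swapIso X Y).inv q p ↔ p.2 = q.1 ∧ p.1 = q.2 :=
  Prod.ext_iff (x := p.swap) (y := q)

/-- The braiding is the swap of factors. -/
instance : SymmetricCategory RelCat.{v} where
  braiding := swapIso
  braiding_naturality_right X Y Z f := by
    refine hom_ext ?_
    rintro ⟨a, b⟩ ⟨c, d⟩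
    simp [exists_carrier_tensor]
  braiding_naturality_left f Z := by
    refine hom_ext ?_
    rintro ⟨a, b⟩ ⟨c, d⟩
    simp [exists_carrier_tensor]
    grind
  hexagon_forward X Y Z := by
    refine hom_ext ?_
    rintro ⟨⟨a, b⟩, c⟩ ⟨d, e, f⟩
    simp [exists_carrier_tensor]
  hexagon_reverse X Y Z := by
    refine hom_ext ?_
    rintro ⟨a, b, c⟩ ⟨⟨d, e⟩, f⟩
    simp [exists_carrier_tensor]
    grind
  symmetry X Y := by
    refine hom_ext ?_
    rintro ⟨a, b⟩ ⟨c, d⟩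
    simp [exists_carrier_tensor]
    grind

end RelSets

/-! ## The functor of atoms -/

section Atoms

variable (C : Type u) [Category.{v} C] [DaggerCategory C] [HasZeroMorphisms C]
  [HasDaggerBiproducts C] [MonoidalCategory C]

variable {C} in
/-- `E(X)`: the set of atoms of `C(I, X)`. -/
def atomSet (X : C) : RelCat.{v} :=
  RelSets.of {x : 𝟙_ C ⟶ X // IsHomAtom x}

variable {C} in
/-- `E(r)`: the relation consisting of the pairs `(x, y)` of atoms with `y† ∘ r ∘ x = 1`. -/
def atomMap {X Y : C} (r : X ⟶ Y) : atomSet X ⟶ atomSet Y :=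
  RelSets.mk (X := atomSet X) (Y := atomSet Y)
    fun x y => x.1 ≫ r ≫ dag y.1 = 𝟙 (𝟙_ C)

/-- `E` as a functor, given that `atomMap` respects identities and composition. -/
def atomFunctor (hid : ∀ X : C, atomMap (𝟙 X) = 𝟙 (atomSet X))
    (hcomp : ∀ (X Y Z : C) (f : X ⟶ Y) (g : Y ⟶ Z), atomMap (f ≫ g) = atomMap f ≫ atomMap g) :
    C ⥤ RelCat.{v} where
  obj X := atomSet X
  map r := atomMap r
  map_id := hid
  map_comp f g := hcomp _ _ _ f g

/-- The relation `{∗} ⟶ E(I)` given by the function `∗ ↦ 1`. -/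
def atomUnit : 𝟙_ RelCat.{v} ⟶ atomSet (𝟙_ C) :=
  RelSets.mk (X := 𝟙_ RelCat.{v}) (Y := atomSet (𝟙_ C)) fun _ z => z.1 = 𝟙 (𝟙_ C)

variable {C} in
/-- The relation `E(X) × E(Y) ⟶ E(X ⊗ Y)` given by the function `(x, y) ↦ x ⊗ y`, where `x ⊗ y` is
regarded as a morphism out of `I` via the unitor `I ⊗ I ≅ I`. -/
def atomTensor (X Y : C) : atomSet X ⊗ atomSet Y ⟶ atomSet (X ⊗ Y) :=
  RelSets.mk (X := atomSet X ⊗ atomSet Y) (Y := atomSet (X ⊗ Y))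
    fun p z => z.1 = (λ_ (𝟙_ C)).inv ≫ (p.1.1 ⊗ₘ p.2.1)

end Atoms

/-! ### Sums of morphisms from dagger biproducts. -/

section SumCalculus

variable {C : Type u} [Category.{v} C] [DaggerCategory C] [HasZeroMorphisms C]

/-! Morphisms of `C` turn out to be Boolean matrices indexed by atoms. The only scalars `I ⟶ I` are
`0` and `1` (`scalar_cases`), and infinite biproducts force `1 + 1 = 1` (`homAdd_one_one`). As `I`
is separating, a morphism is determined by its entries `y† r x` for states `x`, `y`. Nonzero states
satisfy `x† x = 1` (`inner_self`). Axiom (4') splits an object along a state, hence every other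
state into a part below it and a part orthogonal to it (`exists_homAdd_eq_of_state`), as in a
Boolean algebra.

Duals make this algebra atomic (`topState_eq_zero_of_forall_not_isHomAtom`). On an object without
atoms, overlapping states contain orthogonal nonzero ones; these are related by the complement of
the identity, which is therefore above the identity, so the identity is zero. Hence identities are
sums of `z z†` over atoms `z` (`homSum_atoms`), composition is matrix multiplication, and `E` is
functorial and faithful. Sums of `y x†` give fullness, and biproducts of copies of `I` realize all
sets. Duals also make products of atoms jointly epic (`hom_ext_tensorState`), so the atoms of `X ⊗
Y` are exactly the products of atoms. For relations the axioms are checked directly. -/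

theorem dag_injective {C : Type u} [Category.{v} C] [DaggerCategory C] {X Y : C} {f g : X ⟶ Y} (h : dag f = dag g) : f = g := by
  rw [← DaggerCategory.dag_dag f, h, DaggerCategory.dag_dag]

namespace DaggerBiproduct

variable {M : Type v} {X : M → C} (P : DaggerBiproduct X)

theorem hom_ext_inj {Z : C} {f g : P.pt ⟶ Z} (h : ∀ m, P.inj m ≫ f = P.inj m ≫ g) : f = g :=
  Cofan.IsColimit.hom_ext P.isColimit f g h

theorem hom_ext_dag_inj {Z : C} {f g : Z ⟶ P.pt}
    (h : ∀ m, f ≫ dag (P.inj m) = g ≫ dag (P.inj m)) : f = g :=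
  Fan.IsLimit.hom_ext P.isLimit f g h

/-- The morphism out of a biproduct with prescribed components. -/
def desc {Z : C} (f : ∀ m, X m ⟶ Z) : P.pt ⟶ Z :=
  Cofan.IsColimit.desc P.isColimit f

@[simp] theorem inj_desc {Z : C} (f : ∀ m, X m ⟶ Z) (m : M) : P.inj m ≫ P.desc f = f m :=
  Cofan.IsColimit.fac P.isColimit f m

@[simp] theorem diag_dag_inj {X : C} (P : DaggerBiproduct (fun _ : M => X)) (m : M) :
    P.diag ≫ dag (P.inj m) = 𝟙 X :=
  Fan.IsLimit.fac P.isLimit _ m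

@[simp] theorem inj_dag_diag {X : C} (P : DaggerBiproduct (fun _ : M => X)) (m : M) :
    P.inj m ≫ dag P.diag = 𝟙 X :=
  dag_injective (by
    rw [DaggerCategory.dag_comp, DaggerCategory.dag_dag, DaggerCategory.dag_id, diag_dag_inj])

@[simp] theorem inj_map {Y : M → C} (Q : DaggerBiproduct Y) (r : ∀ m, X m ⟶ Y m) (m : M) :
    P.inj m ≫ P.map Q r = r m ≫ Q.inj m :=
  Cofan.IsColimit.fac P.isColimit _ m

end DaggerBiproduct

namespace BinaryDaggerBiproduct

variable {A B : C} (P : BinaryDaggerBiproduct A B)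

theorem inc₁_dag_self : P.inc₁ ≫ dag P.inc₁ = 𝟙 A := P.inj_dag_self ⟨false⟩

theorem inc₂_dag_self : P.inc₂ ≫ dag P.inc₂ = 𝟙 B := P.inj_dag_self ⟨true⟩

theorem inc₁_dag_inc₂ : P.inc₁ ≫ dag P.inc₂ = 0 := P.inj_dag_of_ne ⟨false⟩ ⟨true⟩ (by simp)

end BinaryDaggerBiproduct

variable [HasDaggerBiproducts C]

/-- The two composites of one inclusion of `X ⊕ Y` with the dagger of the other are both zero, and
they are daggers of each other. -/
theorem dag_zero (X Y : C) : dag (0 : X ⟶ Y) = 0 := by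
  let P := biprodOf (pairFamily X Y)
  have h₁ : P.inj ⟨false⟩ ≫ dag (P.inj ⟨true⟩) = 0 := P.inj_dag_of_ne _ _ (by simp)
  have h₂ : P.inj ⟨true⟩ ≫ dag (P.inj ⟨false⟩) = 0 := P.inj_dag_of_ne _ _ (by simp)
  have h₃ := congrArg dag h₁
  rw [DaggerCategory.dag_comp, DaggerCategory.dag_dag, h₂] at h₃
  exact h₃.symm

variable {M N : Type v} {X Y Z : C}

theorem homSum_eq_diag_desc (r : M → (X ⟶ Y)) :
    homSum r = (biprodOf (fun _ : M => X)).diag ≫ (biprodOf (fun _ : M => X)).desc r := by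
  unfold homSum
  congr 1
  refine DaggerBiproduct.hom_ext_inj _ fun m => ?_
  rw [← Category.assoc]
  simp

theorem homSum_comp (r : M → (X ⟶ Y)) (g : Y ⟶ Z) :
    homSum r ≫ g = homSum fun m => r m ≫ g := by
  rw [homSum_eq_diag_desc, homSum_eq_diag_desc, Category.assoc]
  congr 1
  refine DaggerBiproduct.hom_ext_inj _ fun m => ?_
  rw [← Category.assoc]
  simp

theorem dag_homSum (r : M → (X ⟶ Y)) : dag (homSum r) = homSum fun m => dag (r m) := by
  unfold homSum
  simp only [DaggerCategory.dag_comp, DaggerCategory.dag_dag, Category.assoc]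
  congr 2
  refine DaggerBiproduct.hom_ext_inj _ fun m => DaggerBiproduct.hom_ext_dag_inj _ fun n => ?_
  rw [DaggerBiproduct.inj_map, Category.assoc, ← DaggerCategory.dag_comp, DaggerBiproduct.inj_map, DaggerCategory.dag_comp,
    ← Category.assoc]
  rcases eq_or_ne m n with rfl | h
  · rw [DaggerBiproduct.inj_dag_self, Category.assoc, DaggerBiproduct.inj_dag_self,
      Category.id_comp, Category.comp_id]
  · rw [DaggerBiproduct.inj_dag_of_ne _ _ _ h, Category.assoc,
      DaggerBiproduct.inj_dag_of_ne _ _ _ h, zero_comp, comp_zero]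

theorem comp_homSum (f : X ⟶ Y) (r : M → (Y ⟶ Z)) :
    f ≫ homSum r = homSum fun m => f ≫ r m := by
  refine dag_injective ?_
  simp only [DaggerCategory.dag_comp, dag_homSum, homSum_comp]

theorem homSum_eq_single (r : M → (X ⟶ Y)) (m : M) (h : ∀ n, n ≠ m → r n = 0) :
    homSum r = r m := by
  have : (biprodOf (fun _ : M => X)).desc r = dag ((biprodOf (fun _ : M => X)).inj m) ≫ r m := by
    refine DaggerBiproduct.hom_ext_inj _ fun n => ?_
    rw [DaggerBiproduct.inj_desc, ← Category.assoc]
    rcases eq_or_ne n m with rfl | hn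
    · rw [DaggerBiproduct.inj_dag_self, Category.id_comp]
    · rw [DaggerBiproduct.inj_dag_of_ne _ _ _ hn, zero_comp, h n hn]
  rw [homSum_eq_diag_desc, this, ← Category.assoc, DaggerBiproduct.diag_dag_inj, Category.id_comp]

theorem homSum_zero : homSum (fun _ : M => (0 : X ⟶ Y)) = 0 := by
  have := homSum_comp (fun _ : M => 𝟙 X) (0 : X ⟶ Y)
  simpa using this.symm

/-- Each inner sum starts with the same diagonal, which can be pulled out of the outer sum. -/
theorem homSum_comm (r : M → N → (X ⟶ Y)) :
    homSum (fun m => homSum (r m)) = homSum fun n => homSum fun m => r m n := by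
  simp only [fun m => homSum_eq_diag_desc (r m)]
  rw [← comp_homSum, homSum_eq_diag_desc (fun n => homSum fun m => r m n)]
  congr 1
  refine DaggerBiproduct.hom_ext_inj _ fun n => ?_
  rw [comp_homSum]
  simp

/-- Both sides evaluate, in the two orders, the double sum of the matrix supported on the graph of
`e` with entry `r m` at `(n, m)`. -/
theorem homSum_reindex (r : M → (X ⟶ Y)) (e : N → M) (he : Function.Injective e)
    (h : ∀ m, m ∉ Set.range e → r m = 0) : homSum (fun n => r (e n)) = homSum r := by
  classical
  have h₁ : ∀ n, homSum (fun m => if e n = m then r m else 0) = r (e n) := fun n => by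
    rw [homSum_eq_single _ (e n) fun m hm => if_neg hm.symm, if_pos rfl]
  have h₂ : ∀ m, homSum (fun n => if e n = m then r m else 0) = r m := fun m => by
    by_cases hm : m ∈ Set.range e
    · obtain ⟨n, rfl⟩ := hm
      rw [homSum_eq_single _ n fun k hk => if_neg (he.ne hk), if_pos rfl]
    · simp only [h m hm, ite_self, homSum_zero]
  have := homSum_comm fun n m => if e n = m then r m else 0
  simpa only [h₁, h₂] using this

theorem homAdd_comp (r s : X ⟶ Y) (g : Y ⟶ Z) :
    homAdd r s ≫ g = homAdd (r ≫ g) (s ≫ g) := by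
  unfold homAdd
  rw [homSum_comp]
  congr 1
  funext ⟨b⟩
  cases b <;> rfl

theorem comp_homAdd (f : X ⟶ Y) (r s : Y ⟶ Z) :
    f ≫ homAdd r s = homAdd (f ≫ r) (f ≫ s) := by
  unfold homAdd
  rw [comp_homSum]
  congr 1
  funext ⟨b⟩
  cases b <;> rfl

theorem homAdd_zero (r : X ⟶ Y) : homAdd r 0 = r :=
  homSum_eq_single (fun b : ULift.{v} Bool => match b with
    | ⟨false⟩ => r
    | ⟨true⟩ => 0) ⟨false⟩ (by rintro ⟨_ | _⟩ h <;> simp_all)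

theorem zero_homAdd (r : X ⟶ Y) : homAdd 0 r = r :=
  homSum_eq_single (fun b : ULift.{v} Bool => match b with
    | ⟨false⟩ => 0
    | ⟨true⟩ => r) ⟨true⟩ (by rintro ⟨_ | _⟩ h <;> simp_all)

theorem homSum_homAdd (r s : M → (X ⟶ Y)) :
    homSum (fun m => homAdd (r m) (s m)) = homAdd (homSum r) (homSum s) := by
  unfold homAdd
  rw [homSum_comm]
  congr 1
  funext ⟨b⟩
  cases b <;> rfl

-- Each `r n` is the sum of its part at `m` and its part away from `m`; no associativity of the sum
-- is needed.
open Classical in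
theorem homSum_eq_homAdd (r : M → (X ⟶ Y)) (m : M) :
    homSum r = homAdd (r m) (homSum fun n => if n = m then 0 else r n) := by
  have h := homSum_homAdd (fun n => if n = m then r n else 0) (fun n => if n = m then 0 else r n)
  rw [homSum_eq_single (fun n => if n = m then r n else 0) m fun n hn => if_neg hn,
    if_pos rfl] at h
  rw [← h]
  congr 1
  funext n
  split_ifs
  · rw [homAdd_zero]
  · rw [zero_homAdd]

/-- A countably infinite sum of copies of a morphism absorbs one more copy. -/
theorem homSum_nat_const (r : X ⟶ Y) :
    homSum (fun _ : ULift.{v} ℕ => r) = homAdd r (homSum fun _ : ULift.{v} ℕ => r) := by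
  classical
  -- The shift `n ↦ n + 1` identifies the constant sum with the one whose term at `0` is removed.
  have h := homSum_reindex (fun n : ULift.{v} ℕ => if n = ⟨0⟩ then 0 else r)
    (fun n : ULift.{v} ℕ => ⟨n.down + 1⟩)
    (fun a b hab => ULift.ext _ _ (Nat.succ_injective (congrArg ULift.down hab)))
    (fun m hm => if_pos (by
      by_contra h
      exact hm ⟨⟨m.down - 1⟩, ULift.ext _ _ (Nat.succ_pred fun h' => h (ULift.ext _ _ h'))⟩))
  have h' : ∀ n : ULift.{v} ℕ, (⟨n.down + 1⟩ : ULift.{v} ℕ) ≠ ⟨0⟩ := fun n hn =>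
    Nat.succ_ne_zero _ (congrArg ULift.down hn)
  simp only [if_neg (h' _)] at h
  calc _ = homAdd r (homSum fun n : ULift.{v} ℕ => if n = ⟨0⟩ then 0 else r) := by
        rw [homSum_eq_homAdd _ ⟨0⟩]
        congr!
    _ = _ := by rw [← h]

/-- A morphism through a biproduct is the sum of its restrictions to the summands. -/
theorem DaggerBiproduct.homSum_id {X : M → C} (P : DaggerBiproduct X) :
    homSum (fun m => dag (P.inj m) ≫ P.inj m) = 𝟙 P.pt := by
  refine P.hom_ext_inj fun n => ?_
  rw [comp_homSum, homSum_eq_single _ n fun m hm => ?_, ← Category.assoc, P.inj_dag_self,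
    Category.id_comp, Category.comp_id]
  rw [← Category.assoc, P.inj_dag_of_ne _ _ hm.symm, zero_comp]

theorem BinaryDaggerBiproduct.homAdd_id {A B : C} (P : BinaryDaggerBiproduct A B) :
    homAdd (dag P.inc₁ ≫ P.inc₁) (dag P.inc₂ ≫ P.inc₂) = 𝟙 P.pt := by
  rw [← P.homSum_id]
  unfold homAdd
  congr 1
  funext ⟨b⟩
  cases b <;> rfl

theorem exists_isZero (C : Type u) [Category.{v} C] [DaggerCategory C] [HasZeroMorphisms C]
    [HasDaggerBiproducts C] [Nonempty C] : ∃ Z : C, IsZero Z := by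
  obtain ⟨X⟩ := ‹Nonempty C›
  let P := biprodOf (fun _ : PEmpty.{v + 1} => X)
  exact ⟨P.pt, (IsZero.iff_id_eq_zero _).2 (P.hom_ext_inj fun m => m.elim)⟩

theorem hasZeroCokernel_iff (f : X ⟶ Y) :
    HasZeroCokernel f ↔ ∀ (Z : C) (q : Y ⟶ Z), f ≫ q = 0 → q = 0 := by
  constructor
  · rintro ⟨Z, q, w, hZ, ⟨h⟩⟩ W g hg
    obtain ⟨l, hl⟩ := CokernelCofork.IsColimit.desc' h g hg
    rw [← hl, hZ.eq_zero_of_src l, comp_zero]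
  · intro h
    have : Nonempty C := ⟨X⟩
    obtain ⟨Z, hZ⟩ := exists_isZero C
    refine ⟨Z, 0, comp_zero, hZ, ⟨CokernelCofork.IsColimit.ofπ _ _ (fun _ _ => 0) ?_ ?_⟩⟩
    · intro W g hg
      rw [h W g hg, comp_zero]
    · intro W g hg m hm
      exact hZ.eq_zero_of_src m

theorem hasZeroCokernel_comp_iso {f : X ⟶ Y} (hf : HasZeroCokernel f) (e : Y ⟶ Z) [IsIso e] :
    HasZeroCokernel (f ≫ e) := by
  rw [hasZeroCokernel_iff] at hf ⊢
  intro W q hq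
  rw [Category.assoc] at hq
  rw [← cancel_epi e, hf W _ hq, comp_zero]

theorem hasZeroCokernel_id (X : C) : HasZeroCokernel (𝟙 X) := by
  rw [hasZeroCokernel_iff]
  intro W q hq
  simpa using hq

theorem comp_homLE {a b : X ⟶ Y} (h : HomLE a b) (f : Y ⟶ Z) : HomLE (a ≫ f) (b ≫ f) := by
  unfold HomLE at h ⊢
  rw [← homAdd_comp, h]

end SumCalculus

/-! ### Boolean scalars and the order on states. -/

/-- The axioms on the monoidal unit that single out categories of relations. -/
class RelAxioms (C : Type u) [Category.{v} C] [DaggerCategory C] [MonoidalCategory C]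
    [HasZeroMorphisms C] : Prop where
  simple_unit : Simple (𝟙_ C)
  isSeparator_unit : IsSeparator (𝟙_ C)
  existsUnique_top : ∀ X : C, ∃! t : 𝟙_ C ⟶ X, HasZeroCokernel t
  factor : UnitMorphismsFactor C

section States

variable {C : Type u} [Category.{v} C] [DaggerCategory C] [MonoidalCategory C]
  [HasZeroMorphisms C] [RelAxioms C] {X Y Z : C}

theorem hom_ext_state {r s : X ⟶ Y} (h : ∀ x : 𝟙_ C ⟶ X, x ≫ r = x ≫ s) : r = s :=
  (isSeparator_def _).1 RelAxioms.isSeparator_unit r s h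

theorem hom_ext_effect {r s : X ⟶ Y} (h : ∀ y : 𝟙_ C ⟶ Y, r ≫ dag y = s ≫ dag y) : r = s := by
  refine dag_injective (hom_ext_state fun y => dag_injective ?_)
  simp only [DaggerCategory.dag_comp, DaggerCategory.dag_dag, h]

theorem id_unit_ne_zero : 𝟙 (𝟙_ C) ≠ 0 :=
  have : Simple (𝟙_ C) := RelAxioms.simple_unit
  id_nonzero _

/-- The largest state of an object. -/
noncomputable def topState (X : C) : 𝟙_ C ⟶ X :=
  (RelAxioms.existsUnique_top X).choose

theorem eq_topState {t : 𝟙_ C ⟶ X} (h : HasZeroCokernel t) : t = topState X :=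
  (RelAxioms.existsUnique_top X).choose_spec.2 t h

variable [HasDaggerBiproducts C]

/-- By (4'), `a` is a top state followed by a split mono into `I`. Simplicity makes that mono zero
or invertible; if invertible, `a` has zero cokernel, as does the identity, and uniqueness identifies
them. -/
theorem scalar_cases (a : 𝟙_ C ⟶ 𝟙_ C) : a = 0 ∨ a = 𝟙 (𝟙_ C) := by
  obtain ⟨A, B, P, i, t, hi, ht, rfl⟩ := RelAxioms.factor _ a
  have : Simple (𝟙_ C) := RelAxioms.simple_unit
  have h : (P.inc₁ ≫ i) ≫ dag i ≫ dag P.inc₁ = 𝟙 A := by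
    rw [Category.assoc, ← Category.assoc i, hi.1, Category.id_comp, P.inc₁_dag_self]
  have : Mono (P.inc₁ ≫ i) := (SplitMono.mk _ h).mono
  by_cases h0 : P.inc₁ ≫ i = 0
  · exact Or.inl (by rw [h0, comp_zero])
  · have : IsIso (P.inc₁ ≫ i) := isIso_of_mono_of_nonzero h0
    exact Or.inr ((RelAxioms.existsUnique_top _).unique (hasZeroCokernel_comp_iso ht _)
      (hasZeroCokernel_id _))

theorem scalar_ne_zero_iff {a : 𝟙_ C ⟶ 𝟙_ C} : a ≠ 0 ↔ a = 𝟙 (𝟙_ C) :=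
  ⟨(scalar_cases a).resolve_left, fun h => h ▸ id_unit_ne_zero⟩

theorem scalar_ext {a b : 𝟙_ C ⟶ 𝟙_ C} (h : a = 𝟙 (𝟙_ C) ↔ b = 𝟙 (𝟙_ C)) : a = b := by
  rcases scalar_cases a with rfl | rfl
  · rcases scalar_cases b with rfl | rfl
    · rfl
    · exact h.2 rfl
  · exact (h.1 rfl).symm

theorem dag_scalar (a : 𝟙_ C ⟶ 𝟙_ C) : dag a = a := by
  rcases scalar_cases a with rfl | rfl
  · exact dag_zero _ _
  · exact DaggerCategory.dag_id _

theorem comp_scalar_eq_one {a b : 𝟙_ C ⟶ 𝟙_ C} :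
    a ≫ b = 𝟙 (𝟙_ C) ↔ a = 𝟙 (𝟙_ C) ∧ b = 𝟙 (𝟙_ C) := by
  rcases scalar_cases a with rfl | rfl
  · simp [id_unit_ne_zero.symm]
  · simp

/-- An Eilenberg swindle: the countable sum `s` of ones satisfies `s = 1 + s`, which excludes `s =
0` and for `s = 1` is the claim. -/
theorem homAdd_one_one : homAdd (𝟙 (𝟙_ C)) (𝟙 (𝟙_ C)) = 𝟙 (𝟙_ C) := by
  have h := homSum_nat_const (𝟙 (𝟙_ C))
  rcases scalar_cases (homSum fun _ : ULift.{v} ℕ => 𝟙 (𝟙_ C)) with h' | h' <;> rw [h'] at h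
  · rw [homAdd_zero] at h
    exact absurd h.symm id_unit_ne_zero
  · exact h.symm

theorem scalar_homAdd_eq_one {a b : 𝟙_ C ⟶ 𝟙_ C} :
    homAdd a b = 𝟙 (𝟙_ C) ↔ a = 𝟙 (𝟙_ C) ∨ b = 𝟙 (𝟙_ C) := by
  rcases scalar_cases a with rfl | rfl <;> rcases scalar_cases b with rfl | rfl <;>
    simp [homAdd_zero, zero_homAdd, homAdd_one_one]

theorem scalar_homSum_eq_one {M : Type v} {a : M → (𝟙_ C ⟶ 𝟙_ C)} :
    homSum a = 𝟙 (𝟙_ C) ↔ ∃ m, a m = 𝟙 (𝟙_ C) := by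
  constructor
  · intro h
    by_contra! h'
    have : a = fun _ => 0 := funext fun m => (scalar_cases _).resolve_right (h' m)
    rw [this, homSum_zero] at h
    exact id_unit_ne_zero h.symm
  · rintro ⟨m, hm⟩
    rw [homSum_eq_homAdd _ m, scalar_homAdd_eq_one]
    exact Or.inl hm

theorem hom_ext_one {r s : X ⟶ Y} (h : ∀ (x : 𝟙_ C ⟶ X) (y : 𝟙_ C ⟶ Y),
    x ≫ r ≫ dag y = 𝟙 (𝟙_ C) ↔ x ≫ s ≫ dag y = 𝟙 (𝟙_ C)) : r = s :=
  hom_ext_state fun x => hom_ext_effect fun y => by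
    rw [Category.assoc, Category.assoc]
    exact scalar_ext (h x y)

theorem state_ext {a b : 𝟙_ C ⟶ X}
    (h : ∀ y : 𝟙_ C ⟶ X, a ≫ dag y = 𝟙 (𝟙_ C) ↔ b ≫ dag y = 𝟙 (𝟙_ C)) : a = b :=
  hom_ext_effect fun y => scalar_ext (h y)

/-- Addition of scalars is disjunction, so the order is inclusion of the sets of effects with value
`1`; the laws of a partial order follow at once. -/
theorem state_homLE_iff {a b : 𝟙_ C ⟶ X} :
    HomLE a b ↔ ∀ y : 𝟙_ C ⟶ X, a ≫ dag y = 𝟙 (𝟙_ C) → b ≫ dag y = 𝟙 (𝟙_ C) := by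
  constructor
  · intro h y hy
    rw [← h, homAdd_comp, scalar_homAdd_eq_one]
    exact Or.inl hy
  · intro h
    refine state_ext fun y => ?_
    rw [homAdd_comp, scalar_homAdd_eq_one]
    exact ⟨fun h' => h'.elim (h y) id, Or.inr⟩

theorem state_homLE_refl (a : 𝟙_ C ⟶ X) : HomLE a a :=
  state_homLE_iff.2 fun _ => id

theorem state_homLE_antisymm {a b : 𝟙_ C ⟶ X} (h : HomLE a b) (h' : HomLE b a) : a = b :=
  state_ext fun y => ⟨state_homLE_iff.1 h y, state_homLE_iff.1 h' y⟩

theorem state_homLE_trans {a b c : 𝟙_ C ⟶ X} (h : HomLE a b) (h' : HomLE b c) : HomLE a c :=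
  state_homLE_iff.2 fun y hy => state_homLE_iff.1 h' y (state_homLE_iff.1 h y hy)

theorem inner_symm {a b : 𝟙_ C ⟶ X} :
    a ≫ dag b = 𝟙 (𝟙_ C) ↔ b ≫ dag a = 𝟙 (𝟙_ C) := by
  rw [← dag_scalar (a ≫ dag b), DaggerCategory.dag_comp, DaggerCategory.dag_dag]

/-- Pairing with a larger state. -/
theorem inner_mono {a b c d : 𝟙_ C ⟶ X} (h : a ≫ dag b = 𝟙 (𝟙_ C)) (hac : HomLE a c)
    (hbd : HomLE b d) : c ≫ dag d = 𝟙 (𝟙_ C) :=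
  inner_symm.1 (state_homLE_iff.1 hbd _ (inner_symm.1 (state_homLE_iff.1 hac _ h)))

/-- For `a = t ≫ j` with `j` dagger monic, `a ≫ dag a = t ≫ dag t`; were this zero, the zero
cokernel of `t` would force `dag t = 0`. -/
theorem inner_self {a : 𝟙_ C ⟶ X} (ha : a ≠ 0) : a ≫ dag a = 𝟙 (𝟙_ C) := by
  obtain ⟨A, B, P, i, t, hi, ht, rfl⟩ := RelAxioms.factor _ a
  refine scalar_ne_zero_iff.1 fun h => ha ?_
  have h₁ : t ≫ dag t = 0 := by
    rw [← h]
    simp only [DaggerCategory.dag_comp, Category.assoc]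
    rw [← Category.assoc i, hi.1, Category.id_comp, ← Category.assoc P.inc₁, P.inc₁_dag_self,
      Category.id_comp]
  have h₂ := (hasZeroCokernel_iff t).1 ht _ _ h₁
  have : t = 0 := dag_injective (by rw [h₂, dag_zero])
  rw [this, zero_comp]

theorem hasZeroCokernel_of_inner {t : 𝟙_ C ⟶ X} (h : ∀ y : 𝟙_ C ⟶ X, t ≫ dag y = 0 → y = 0) :
    HasZeroCokernel t := by
  rw [hasZeroCokernel_iff]
  intro Z q hq
  refine hom_ext_effect fun z => ?_
  have := h (dag (q ≫ dag z)) (by rw [DaggerCategory.dag_dag, ← Category.assoc, hq, zero_comp])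
  rw [zero_comp]
  exact dag_injective (by rw [this, dag_zero])

theorem homLE_topState (a : 𝟙_ C ⟶ X) : HomLE a (topState X) := by
  -- The sum of all states is above each of them and orthogonal to no nonzero one, so it has zero
  -- cokernel.
  rw [← eq_topState (t := homSum fun x : 𝟙_ C ⟶ X => x)]
  · refine state_homLE_iff.2 fun y hy => ?_
    rw [homSum_comp, scalar_homSum_eq_one]
    exact ⟨a, hy⟩
  · refine hasZeroCokernel_of_inner fun y hy => ?_
    by_contra h
    refine id_unit_ne_zero (C := C) ?_
    rw [← hy, eq_comm, homSum_comp, scalar_homSum_eq_one]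
    exact ⟨y, inner_self h⟩

theorem topState_inner {y : 𝟙_ C ⟶ X} (hy : y ≠ 0) : topState X ≫ dag y = 𝟙 (𝟙_ C) :=
  inner_mono (inner_self hy) (homLE_topState y) (state_homLE_refl y)

theorem topState_comp {f : X ⟶ 𝟙_ C} (hf : f ≠ 0) : topState X ≫ f = 𝟙 (𝟙_ C) := by
  have := topState_inner (y := dag f) fun h => hf (dag_injective (by rw [h, dag_zero]))
  rwa [DaggerCategory.dag_dag] at this

/-- Each state is the image of the largest state of a direct summand. -/
theorem exists_summand (a : 𝟙_ C ⟶ X) : ∃ (A B : C) (j : A ⟶ X) (k : B ⟶ X),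
    a = topState A ≫ j ∧ j ≫ dag j = 𝟙 A ∧ k ≫ dag k = 𝟙 B ∧ j ≫ dag k = 0 ∧
      homAdd (dag j ≫ j) (dag k ≫ k) = 𝟙 X := by
  obtain ⟨A, B, P, i, t, hi, ht, rfl⟩ := RelAxioms.factor _ a
  have h : ∀ {U V : C} (f : U ⟶ P.pt) (g : V ⟶ P.pt),
      (f ≫ i) ≫ dag (g ≫ i) = f ≫ dag g := fun f g => by
    rw [DaggerCategory.dag_comp, Category.assoc, ← Category.assoc i, hi.1, Category.id_comp]
  refine ⟨A, B, P.inc₁ ≫ i, P.inc₂ ≫ i, ?_, ?_, ?_, ?_, ?_⟩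
  · rw [eq_topState ht]
  · rw [h, P.inc₁_dag_self]
  · rw [h, P.inc₂_dag_self]
  · rw [h, P.inc₁_dag_inc₂]
  · have h₁ := congrArg (fun f => dag i ≫ f ≫ i) P.homAdd_id
    simp only [homAdd_comp, comp_homAdd, Category.id_comp, hi.2] at h₁
    rw [← h₁]
    simp only [DaggerCategory.dag_comp, Category.assoc]

/-- Each state `a` decomposes each state into a part below `a` and a part orthogonal to `a`. -/
theorem exists_homAdd_eq_of_state (a b : 𝟙_ C ⟶ X) : ∃ p q : 𝟙_ C ⟶ X,
    homAdd p q = b ∧ HomLE p a ∧ a ≫ dag q = 0 := by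
  obtain ⟨A, B, j, k, rfl, hj, hk, hjk, h⟩ := exists_summand a
  -- The projections of `b` onto the summand whose top state gives `a` and onto the complementary
  -- summand.
  refine ⟨b ≫ dag j ≫ j, b ≫ dag k ≫ k, ?_, ?_, ?_⟩
  · rw [← comp_homAdd, h, Category.comp_id]
  · rw [← Category.assoc]
    exact comp_homLE (homLE_topState _) _
  · simp only [DaggerCategory.dag_comp, DaggerCategory.dag_dag, Category.assoc]
    rw [← Category.assoc j, hjk, zero_comp, comp_zero]

theorem exists_compl (a : 𝟙_ C ⟶ X) : ∃ c : 𝟙_ C ⟶ X,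
    homAdd a c = topState X ∧ a ≫ dag c = 0 := by
  obtain ⟨p, q, h, hp, hq⟩ := exists_homAdd_eq_of_state a (topState X)
  -- From `p ≤ a` and `p + q = ⊤` it follows that `a + q = ⊤`.
  refine ⟨q, state_homLE_antisymm (homLE_topState _) (state_homLE_iff.2 fun y hy => ?_), hq⟩
  rw [← h, homAdd_comp, scalar_homAdd_eq_one] at hy
  rw [homAdd_comp, scalar_homAdd_eq_one]
  exact hy.imp_left (state_homLE_iff.1 hp y)

theorem homLE_homAdd_left (a b : 𝟙_ C ⟶ X) : HomLE a (homAdd a b) :=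
  state_homLE_iff.2 fun y hy => by
    rw [homAdd_comp, scalar_homAdd_eq_one]
    exact Or.inl hy

theorem homLE_homAdd_right (a b : 𝟙_ C ⟶ X) : HomLE b (homAdd a b) :=
  state_homLE_iff.2 fun y hy => by
    rw [homAdd_comp, scalar_homAdd_eq_one]
    exact Or.inr hy

/-- Two states that are not orthogonal have a common nonzero lower bound. -/
theorem exists_homLE_of_inner {a b : 𝟙_ C ⟶ X} (h : a ≫ dag b = 𝟙 (𝟙_ C)) :
    ∃ p : 𝟙_ C ⟶ X, p ≠ 0 ∧ HomLE p a ∧ HomLE p b := by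
  obtain ⟨p, q, hb, hp, hq⟩ := exists_homAdd_eq_of_state a b
  refine ⟨p, ?_, hp, hb ▸ homLE_homAdd_left p q⟩
  rintro rfl
  rw [zero_homAdd] at hb
  rw [← hb, hq] at h
  exact id_unit_ne_zero h.symm

/-- A proper part of a state leaves a nonzero orthogonal part. -/
theorem exists_orthogonal_of_homLE {a b : 𝟙_ C ⟶ X} (hab : HomLE a b) (hne : a ≠ b) :
    ∃ q : 𝟙_ C ⟶ X, q ≠ 0 ∧ HomLE q b ∧ a ≫ dag q = 0 := by
  obtain ⟨p, q, hb, hp, hq⟩ := exists_homAdd_eq_of_state a b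
  refine ⟨q, ?_, hb ▸ homLE_homAdd_right p q, hq⟩
  rintro rfl
  rw [homAdd_zero] at hb
  exact hne (state_homLE_antisymm hab (hb ▸ hp))

/-! ### Atoms -/

theorem IsHomAtom.homLE_of_inner {a b : 𝟙_ C ⟶ X} (ha : IsHomAtom a)
    (h : a ≫ dag b = 𝟙 (𝟙_ C)) : HomLE a b := by
  obtain ⟨p, hp, hpa, hpb⟩ := exists_homLE_of_inner h
  rcases ha.2 p hpa with rfl | rfl
  · exact absurd rfl hp
  · exact hpb

theorem IsHomAtom.eq_of_inner {a b : 𝟙_ C ⟶ X} (ha : IsHomAtom a) (hb : IsHomAtom b)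
    (h : a ≫ dag b = 𝟙 (𝟙_ C)) : a = b :=
  state_homLE_antisymm (ha.homLE_of_inner h) (hb.homLE_of_inner (inner_symm.1 h))

theorem IsHomAtom.inner_eq_one_iff {a b : 𝟙_ C ⟶ X} (ha : IsHomAtom a) (hb : IsHomAtom b) :
    a ≫ dag b = 𝟙 (𝟙_ C) ↔ a = b :=
  ⟨ha.eq_of_inner hb, fun h => h ▸ inner_self ha.1⟩

end States

/-! ### Existence of atoms, from duals. -/

section Atomicity

variable {C : Type u} [Category.{v} C] [DaggerCategory C] [MonoidalCategory C]
  [HasZeroMorphisms C] [RelAxioms C] [HasDaggerBiproducts C]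

/-- The effect on `D ⊗ A`, for `D` dual to `A`, that tests the name of an endomorphism `r` of `A`
against the states `x` and `y`; see `unname_inner`. -/
def matrixEffect {A : C} (D : C) [ExactPairing D A] (x y : 𝟙_ C ⟶ A) : D ⊗ A ⟶ 𝟙_ C :=
  (λ_ (D ⊗ A)).inv ≫ x ▷ (D ⊗ A) ≫ (tensorLeftHomEquiv (D ⊗ A) D A A).symm (𝟙 _) ≫ dag y

omit [HasZeroMorphisms C] [RelAxioms C] [HasDaggerBiproducts C] in
theorem unname_inner {A : C} (D : C) [ExactPairing D A] (m : 𝟙_ C ⟶ D ⊗ A) (x y : 𝟙_ C ⟶ A) :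
    x ≫ ((ρ_ A).inv ≫ (tensorLeftHomEquiv (𝟙_ C) D A A).symm m) ≫ dag y =
      m ≫ matrixEffect D x y := by
  have h := tensorLeftHomEquiv_symm_naturality (Y := D) (Y' := A) (Z := A) m (𝟙 _)
  rw [Category.comp_id] at h
  rw [h, matrixEffect, leftUnitor_inv_naturality_assoc, whisker_exchange_assoc,
    unitors_inv_equal]
  simp only [Category.assoc, rightUnitor_inv_naturality_assoc]

theorem exists_homLE_ne_of_not_isHomAtom {X : C} {z : 𝟙_ C ⟶ X} (hz : z ≠ 0)
    (h : ¬ IsHomAtom z) : ∃ y q : 𝟙_ C ⟶ X,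
      y ≠ 0 ∧ q ≠ 0 ∧ HomLE y z ∧ HomLE q z ∧ y ≫ dag q = 0 := by
  have : ∃ y : 𝟙_ C ⟶ X, HomLE y z ∧ y ≠ 0 ∧ y ≠ z := by
    by_contra! h'
    exact h ⟨hz, fun y hy => or_iff_not_imp_left.2 (h' y hy)⟩
  obtain ⟨y, hyz, hy, hne⟩ := this
  obtain ⟨q, hq, hqz, hyq⟩ := exists_orthogonal_of_homLE hyz hne
  exact ⟨y, q, hy, hq, hyz, hqz, hyq⟩

/-- An object with a dual and without atoms is a zero object: the complement of the name of its
identity would be above the name of its identity. -/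
theorem topState_eq_zero_of_forall_not_isHomAtom {A : C} (D : C) [ExactPairing D A]
    (h : ∀ x : 𝟙_ C ⟶ A, ¬ IsHomAtom x) : topState A = 0 := by
  let U := tensorLeftHomEquiv (𝟙_ C) D A A
  -- `n` is the name of the identity of `A`, so its matrix entries are inner products.
  obtain ⟨n, hn⟩ : ∃ n : 𝟙_ C ⟶ D ⊗ A, ∀ x y : 𝟙_ C ⟶ A,
      n ≫ matrixEffect D x y = x ≫ dag y :=
    ⟨U (ρ_ A).hom, fun x y => by rw [← unname_inner]; simp [U]⟩
  have hne : ∀ x y : 𝟙_ C ⟶ A, x ≠ 0 → y ≠ 0 → matrixEffect D x y ≠ 0 := by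
    intro x y hx hy h0
    -- The name of the rank-one morphism `dag x ≫ y` has entry `1` at `(x, y)`.
    have h₁ := unname_inner D (U ((ρ_ A).hom ≫ dag x ≫ y)) x y
    rw [h0, comp_zero] at h₁
    simp only [U, Equiv.symm_apply_apply, Iso.inv_hom_id_assoc, Category.assoc] at h₁
    rw [inner_self hy, Category.comp_id, inner_self hx] at h₁
    exact id_unit_ne_zero h₁
  obtain ⟨c, hc, hnc⟩ := exists_compl n
  have hle : homAdd n c = c := by
    refine U.symm.injective ((cancel_epi (ρ_ A).inv).1 (hom_ext_one fun x y => ?_))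
    rw [unname_inner, unname_inner, homAdd_comp, scalar_homAdd_eq_one]
    refine ⟨fun h' => h'.elim (fun h₁ => ?_) id, Or.inr⟩
    rw [hn] at h₁
    -- The overlap `z` of `x` and `y` is not an atom, so it contains orthogonal nonzero `p` and `q`.
    -- The entry of `n + c = ⊤` at `(p, q)` is `1` and that of `n` is `0`, so that of `c` is `1`;
    -- monotonicity carries this to `(x, y)`.
    obtain ⟨z, hz, hzx, hzy⟩ := exists_homLE_of_inner h₁
    obtain ⟨p, q, hp, hq, hpz, hqz, hpq⟩ := exists_homLE_ne_of_not_isHomAtom hz (h z)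
    have h₂ := topState_comp (hne p q hp hq)
    rw [← hc, homAdd_comp, hn, hpq, zero_homAdd, ← unname_inner, ← Category.assoc] at h₂
    rw [← unname_inner, ← Category.assoc]
    exact inner_mono h₂ (comp_homLE (state_homLE_trans hpz hzx) _) (state_homLE_trans hqz hzy)
  have hn0 : n = 0 := by
    by_contra hn0
    have h₁ := state_homLE_iff.1 hle n (inner_self hn0)
    rw [inner_symm, hnc] at h₁
    exact id_unit_ne_zero h₁.symm
  by_contra h0
  have h₁ := hn (topState A) (topState A)
  rw [hn0, zero_comp, inner_self h0] at h₁
  exact id_unit_ne_zero h₁.symm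

variable [SymmetricCategory C] [DaggerCompactClosed C] {X Y Z : C}

/-- The summand cut out by `a` has a nonzero top state, hence an atom `x`. A state below `x ≫ j` has
no component in the other summand, so it comes from a state below `x`. -/
theorem exists_isHomAtom_homLE {a : 𝟙_ C ⟶ X} (ha : a ≠ 0) :
    ∃ x : 𝟙_ C ⟶ X, IsHomAtom x ∧ HomLE x a := by
  obtain ⟨A, B, j, k, rfl, hj, hk, hjk, h⟩ := exists_summand a
  have hA : ∃ x : 𝟙_ C ⟶ A, IsHomAtom x := by
    by_contra! h'
    obtain ⟨D, ⟨_, -⟩⟩ := DaggerCompactClosed.exists_dual A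
    exact ha (by rw [topState_eq_zero_of_forall_not_isHomAtom D h', zero_comp])
  obtain ⟨x, hx⟩ := hA
  refine ⟨x ≫ j, ⟨fun h0 => hx.1 ?_, fun y hy => ?_⟩, comp_homLE (homLE_topState x) j⟩
  · rw [← Category.comp_id x, ← hj, ← Category.assoc, h0, zero_comp]
  · have h₁ : y ≫ dag k = 0 := by
      have := comp_homLE hy (dag k)
      rw [Category.assoc, hjk, comp_zero] at this
      unfold HomLE at this
      rwa [homAdd_zero] at this
    have h₂ : y = (y ≫ dag j) ≫ j := by
      have := congrArg (fun f => y ≫ f) h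
      simp only [comp_homAdd, Category.comp_id] at this
      rw [← Category.assoc y (dag k), h₁, zero_comp, homAdd_zero] at this
      rw [Category.assoc, this]
    have h₃ := comp_homLE hy (dag j)
    rw [Category.assoc, hj, Category.comp_id] at h₃
    rcases hx.2 _ h₃ with h₄ | h₄
    · exact Or.inl (by rw [h₂, h₄, zero_comp])
    · exact Or.inr (by rw [h₂, h₄])

/-- Each identity morphism is the sum of the projections onto the atoms. -/
theorem homSum_atoms (X : C) :
    homSum (fun z : {x : 𝟙_ C ⟶ X // IsHomAtom x} => dag z.1 ≫ z.1) = 𝟙 X := by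
  refine hom_ext_one fun x y => ?_
  rw [homSum_comp, comp_homSum, scalar_homSum_eq_one, Category.id_comp]
  simp only [Category.assoc]
  simp only [← Category.assoc x, comp_scalar_eq_one]
  constructor
  · rintro ⟨z, hz, hz'⟩
    exact state_homLE_iff.1 (z.2.homLE_of_inner (inner_symm.1 hz)) _ hz'
  · intro h
    obtain ⟨p, hp, hpx, hpy⟩ := exists_homLE_of_inner h
    obtain ⟨z, hz, hzp⟩ := exists_isHomAtom_homLE hp
    exact ⟨⟨z, hz⟩, inner_mono (inner_self hz.1) (state_homLE_trans hzp hpx)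
      (state_homLE_refl z), inner_mono (inner_self hz.1) (state_homLE_refl z)
      (state_homLE_trans hzp hpy)⟩

theorem hom_ext_atom {r s : X ⟶ Y} (h : ∀ x : 𝟙_ C ⟶ X, IsHomAtom x → x ≫ r = x ≫ s) :
    r = s := by
  rw [← Category.id_comp r, ← Category.id_comp s, ← homSum_atoms X, homSum_comp, homSum_comp]
  congr 1
  funext z
  rw [Category.assoc, Category.assoc, h z.1 z.2]

theorem hom_ext_atoms {r s : X ⟶ Y} (h : ∀ (x : 𝟙_ C ⟶ X) (y : 𝟙_ C ⟶ Y), IsHomAtom x →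
    IsHomAtom y → (x ≫ r ≫ dag y = 𝟙 (𝟙_ C) ↔ x ≫ s ≫ dag y = 𝟙 (𝟙_ C))) : r = s := by
  refine hom_ext_atom fun x hx => dag_injective (hom_ext_atom fun y hy => dag_injective ?_)
  simp only [DaggerCategory.dag_comp, DaggerCategory.dag_dag, Category.assoc]
  exact scalar_ext (h x y hx hy)

/-- Composition through `Y` is matrix multiplication with respect to the atoms of `Y`. -/
theorem comp_eq_one_iff_exists_atom (f : 𝟙_ C ⟶ Y) (g : Y ⟶ 𝟙_ C) :
    f ≫ g = 𝟙 (𝟙_ C) ↔ ∃ z : 𝟙_ C ⟶ Y, IsHomAtom z ∧ f ≫ dag z = 𝟙 (𝟙_ C) ∧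
      z ≫ g = 𝟙 (𝟙_ C) := by
  have h : f ≫ g = homSum fun z : {x : 𝟙_ C ⟶ Y // IsHomAtom x} => (f ≫ dag z.1) ≫ z.1 ≫ g := by
    conv_lhs => rw [← Category.id_comp g, ← homSum_atoms Y, homSum_comp, comp_homSum]
    simp only [Category.assoc]
  rw [h, scalar_homSum_eq_one]
  simp only [comp_scalar_eq_one, Subtype.exists, exists_prop]

end Atomicity

/-! ### Products of states. -/

section TensorStates

variable {C : Type u} [Category.{v} C] [MonoidalCategory C]

/-- The tensor product of two states, as a state. -/
def tensorState {X Y : C} (x : 𝟙_ C ⟶ X) (y : 𝟙_ C ⟶ Y) : 𝟙_ C ⟶ X ⊗ Y :=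
  (λ_ (𝟙_ C)).inv ≫ (x ⊗ₘ y)

variable {X Y Z X' Y' : C}

theorem tensorState_comp (x : 𝟙_ C ⟶ X) (y : 𝟙_ C ⟶ Y) (f : X ⟶ X') (g : Y ⟶ Y') :
    tensorState x y ≫ (f ⊗ₘ g) = tensorState (x ≫ f) (y ≫ g) := by
  simp [tensorState]

theorem tensorState_leftUnitor (x : 𝟙_ C ⟶ X) :
    tensorState (𝟙 (𝟙_ C)) x ≫ (λ_ X).hom = x := by
  simp [tensorState]

theorem tensorState_rightUnitor (x : 𝟙_ C ⟶ X) :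
    tensorState x (𝟙 (𝟙_ C)) ≫ (ρ_ X).hom = x := by
  simp [tensorState, unitors_inv_equal]

theorem tensorState_associator (x : 𝟙_ C ⟶ X) (y : 𝟙_ C ⟶ Y) (z : 𝟙_ C ⟶ Z) :
    tensorState (tensorState x y) z ≫ (α_ X Y Z).hom = tensorState x (tensorState y z) := by
  have h : ((λ_ (𝟙_ C)).inv ▷ 𝟙_ C) ≫ (α_ (𝟙_ C) (𝟙_ C) (𝟙_ C)).hom =
      𝟙_ C ◁ (λ_ (𝟙_ C)).inv := by
    monoidal
  have h₁ : ((λ_ (𝟙_ C)).inv ≫ (x ⊗ₘ y)) ⊗ₘ z = (λ_ (𝟙_ C)).inv ▷ 𝟙_ C ≫ ((x ⊗ₘ y) ⊗ₘ z) := by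
    rw [← tensorHom_id, tensorHom_comp_tensorHom, Category.id_comp]
  have h₂ : x ⊗ₘ ((λ_ (𝟙_ C)).inv ≫ (y ⊗ₘ z)) = 𝟙_ C ◁ (λ_ (𝟙_ C)).inv ≫ (x ⊗ₘ (y ⊗ₘ z)) := by
    rw [← id_tensorHom, tensorHom_comp_tensorHom, Category.id_comp]
  rw [tensorState, tensorState, tensorState, tensorState, h₁, h₂, Category.assoc, Category.assoc,
    associator_naturality, reassoc_of% h]

theorem tensorState_braiding [BraidedCategory C] (x : 𝟙_ C ⟶ X) (y : 𝟙_ C ⟶ Y) :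
    tensorState x y ≫ (β_ X Y).hom = tensorState y x := by
  simp [tensorState, BraidedCategory.braiding_naturality, unitors_inv_equal]

/-- This is what makes inner products of product states multiplicative. -/
theorem tensorState_scalar (a b : 𝟙_ C ⟶ 𝟙_ C) :
    tensorState a b ≫ (λ_ (𝟙_ C)).hom = a ≫ b := by
  rw [tensorState, MonoidalCategory.tensorHom_def, Category.assoc, Category.assoc, leftUnitor_naturality,
    unitors_equal, rightUnitor_naturality_assoc, unitors_inv_equal, Iso.inv_hom_id_assoc]

end TensorStates

/-! ### Atoms of a tensor product. -/

section AtomTensor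

variable {C : Type u} [Category.{v} C] [DaggerCategory C] [MonoidalCategory C]
  [SymmetricCategory C] [DaggerCompactClosed C] {X Y Z X' Y' : C}

theorem dag_tensorState (x : 𝟙_ C ⟶ X) (y : 𝟙_ C ⟶ Y) :
    dag (tensorState x y) = (dag x ⊗ₘ dag y) ≫ (λ_ (𝟙_ C)).hom := by
  have h : dag (λ_ (𝟙_ C)).inv = (λ_ (𝟙_ C)).hom := by
    have := (DaggerSymmetricMonoidal.leftUnitor_dag (𝟙_ C)).1
    rw [← Iso.eq_inv_comp, Category.comp_id] at this
    rw [← this, DaggerCategory.dag_dag]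
  rw [tensorState, DaggerCategory.dag_comp, DaggerSymmetricMonoidal.dag_tensor, h]

variable [HasZeroMorphisms C] [RelAxioms C] [HasDaggerBiproducts C]

theorem tensorState_inner (x : 𝟙_ C ⟶ X) (y : 𝟙_ C ⟶ Y) (f : X ⟶ X') (g : Y ⟶ Y')
    (x' : 𝟙_ C ⟶ X') (y' : 𝟙_ C ⟶ Y') :
    tensorState x y ≫ (f ⊗ₘ g) ≫ dag (tensorState x' y') = 𝟙 (𝟙_ C) ↔
      x ≫ f ≫ dag x' = 𝟙 (𝟙_ C) ∧ y ≫ g ≫ dag y' = 𝟙 (𝟙_ C) := by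
  rw [dag_tensorState, ← Category.assoc, tensorState_comp, ← Category.assoc, tensorState_comp,
    tensorState_scalar, comp_scalar_eq_one, Category.assoc, Category.assoc]

theorem tensorState_inner_id (x x' : 𝟙_ C ⟶ X) (y y' : 𝟙_ C ⟶ Y) :
    tensorState x y ≫ dag (tensorState x' y') = 𝟙 (𝟙_ C) ↔
      x ≫ dag x' = 𝟙 (𝟙_ C) ∧ y ≫ dag y' = 𝟙 (𝟙_ C) := by
  simpa using tensorState_inner x y (𝟙 X) (𝟙 Y) x' y'

/-- Tensor products of atoms are jointly epic. -/
theorem hom_ext_tensorState {r s : X ⊗ Y ⟶ Z} (h : ∀ (x : 𝟙_ C ⟶ X) (y : 𝟙_ C ⟶ Y),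
    IsHomAtom x → IsHomAtom y → tensorState x y ≫ r = tensorState x y ≫ s) : r = s := by
  obtain ⟨D, ⟨_, -⟩⟩ := DaggerCompactClosed.exists_dual X
  -- Currying `X` through its dual allows testing on atoms of `Y`; after uncurrying, atoms of `X`
  -- are tested.
  refine (tensorLeftHomEquiv Y D X Z).injective (hom_ext_atom fun y hy =>
    (tensorLeftHomEquiv _ D X Z).symm.injective ?_)
  rw [tensorLeftHomEquiv_symm_naturality, tensorLeftHomEquiv_symm_naturality,
    Equiv.symm_apply_apply, Equiv.symm_apply_apply]
  refine (cancel_epi (ρ_ X).inv).1 (hom_ext_atom fun x hx => ?_)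
  have h₁ : x ≫ (ρ_ X).inv ≫ X ◁ y = tensorState x y := by
    rw [tensorState, MonoidalCategory.tensorHom_def, rightUnitor_inv_naturality_assoc, unitors_inv_equal]
  simpa only [← h₁, Category.assoc] using h x y hx hy

/-- The atom `a` lies below the product. Conversely, the only product of atoms not orthogonal to
`tensorState x y` is itself, and products of atoms suffice to compare effects. -/
theorem eq_tensorState {a : 𝟙_ C ⟶ X ⊗ Y} (ha : IsHomAtom a) {x : 𝟙_ C ⟶ X} {y : 𝟙_ C ⟶ Y}
    (hx : IsHomAtom x) (hy : IsHomAtom y) (h : a ≫ dag (tensorState x y) = 𝟙 (𝟙_ C)) :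
    a = tensorState x y := by
  have hle := ha.homLE_of_inner h
  refine dag_injective (hom_ext_tensorState fun x' y' hx' hy' => scalar_ext ?_)
  rw [inner_symm]
  refine ⟨fun h' => inner_symm.1 (state_homLE_iff.1 hle _ h'), fun h' => ?_⟩
  rw [tensorState_inner_id, hx'.inner_eq_one_iff hx, hy'.inner_eq_one_iff hy] at h'
  rwa [h'.1, h'.2]

/-- Otherwise `dag a` would vanish on all products of atoms. -/
theorem exists_inner_tensorState {a : 𝟙_ C ⟶ X ⊗ Y} (ha : a ≠ 0) :
    ∃ (x : 𝟙_ C ⟶ X) (y : 𝟙_ C ⟶ Y), IsHomAtom x ∧ IsHomAtom y ∧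
      a ≫ dag (tensorState x y) = 𝟙 (𝟙_ C) := by
  by_contra! h
  refine ha (dag_injective (hom_ext_tensorState fun x y hx hy => ?_))
  rw [dag_zero, comp_zero]
  refine (scalar_cases _).resolve_right fun h' => h x y hx hy (inner_symm.1 h')

/-- Some atom lies below the nonzero product, and `eq_tensorState` identifies the two. -/
theorem IsHomAtom.tensorState {x : 𝟙_ C ⟶ X} {y : 𝟙_ C ⟶ Y} (hx : IsHomAtom x)
    (hy : IsHomAtom y) : IsHomAtom (tensorState x y) := by
  have h := (tensorState_inner_id x x y y).2 ⟨inner_self hx.1, inner_self hy.1⟩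
  obtain ⟨a, ha, hle⟩ := exists_isHomAtom_homLE (a := _root_.tensorState x y) (by
    intro h0
    rw [h0, zero_comp] at h
    exact id_unit_ne_zero h.symm)
  rw [← eq_tensorState ha hx hy (inner_mono (inner_self ha.1) (state_homLE_refl a) hle)]
  exact ha

theorem IsHomAtom.exists_eq_tensorState {a : 𝟙_ C ⟶ X ⊗ Y} (ha : IsHomAtom a) :
    ∃ (x : 𝟙_ C ⟶ X) (y : 𝟙_ C ⟶ Y), IsHomAtom x ∧ IsHomAtom y ∧ a = _root_.tensorState x y := by
  obtain ⟨x, y, hx, hy, h⟩ := exists_inner_tensorState ha.1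
  exact ⟨x, y, hx, hy, eq_tensorState ha hx hy h⟩

end AtomTensor

/-! ### The functor of atoms: equivalence and monoidal structure. -/

section AtomFunctor

variable {C : Type u} [Category.{v} C] [DaggerCategory C] [MonoidalCategory C]
  [HasZeroMorphisms C] [HasDaggerBiproducts C]

open RelSets

theorem rel_atomMap {X Y : C} (r : X ⟶ Y) (x : carrier (atomSet X)) (y : carrier (atomSet Y)) :
    rel (atomMap r) x y ↔ x.1 ≫ r ≫ dag y.1 = 𝟙 (𝟙_ C) := Iff.rfl

variable [RelAxioms C]

theorem rel_atomMap_of_isHomAtom {X Y : C} (r : X ⟶ Y) (x : carrier (atomSet X))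
    (y : carrier (atomSet Y)) (h : IsHomAtom (x.1 ≫ r)) :
    rel (atomMap r) x y ↔ x.1 ≫ r = y.1 := by
  rw [rel_atomMap, ← Category.assoc, h.inner_eq_one_iff y.2]

theorem atomMap_id (X : C) : atomMap (𝟙 X) = 𝟙 (atomSet X) := by
  refine hom_ext fun x y => ?_
  rw [rel_atomMap_of_isHomAtom _ _ _ (by rw [Category.comp_id]; exact x.2), Category.comp_id,
    rel_id]
  exact Subtype.ext_iff.symm

theorem atomMap_dag {X Y : C} (f : X ⟶ Y) : atomMap (dag f) = dag (atomMap f) := by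
  refine hom_ext fun y x => ?_
  rw [rel_dag, rel_atomMap, rel_atomMap, ← Category.assoc x.1, inner_symm,
    DaggerCategory.dag_comp]

theorem isHomAtom_id_unit : IsHomAtom (𝟙 (𝟙_ C)) :=
  ⟨id_unit_ne_zero, fun y _ => scalar_cases y⟩

theorem rel_atomUnit (p : PUnit.{v + 1}) (z : carrier (atomSet (𝟙_ C))) :
    rel (atomUnit C) p z ↔ ⟨_, isHomAtom_id_unit⟩ = z :=
  ⟨fun h => Subtype.ext (Eq.symm h), fun h => (congrArg Subtype.val h).symm⟩

theorem isDaggerIso_atomUnit : IsDaggerIso (atomUnit C) := by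
  constructor
  · refine hom_ext fun x y => ?_
    rw [rel_comp, rel_id]
    exact ⟨fun _ => rfl, fun _ => ⟨⟨_, isHomAtom_id_unit⟩, rfl, rfl⟩⟩
  · refine hom_ext fun x y => ?_
    rw [rel_comp, rel_id]
    constructor
    · rintro ⟨_, hx, hy⟩
      exact Subtype.ext ((show x.1 = _ from hx).trans (show y.1 = _ from hy).symm)
    · rintro rfl
      exact ⟨PUnit.unit, scalar_ne_zero_iff.1 x.2.1, scalar_ne_zero_iff.1 x.2.1⟩

/-- A state below `P.inj m` has zero components at the other indices, and its component at `m` is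
`0` or `1`. -/
theorem isHomAtom_inj {M : Type v} (P : DaggerBiproduct fun _ : M => 𝟙_ C) (m : M) :
    IsHomAtom (P.inj m) := by
  refine ⟨fun h => ?_, fun y hy => or_iff_not_imp_left.2 fun hy0 => ?_⟩
  · have := P.inj_dag_self m
    rw [h, zero_comp] at this
    exact id_unit_ne_zero this.symm
  · have h : ∀ n, n ≠ m → y ≫ dag (P.inj n) = 0 := fun n hn => by
      have h₁ := comp_homLE hy (dag (P.inj n))
      rw [P.inj_dag_of_ne _ _ hn.symm] at h₁
      exact (homAdd_zero _).symm.trans h₁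
    have h' : y ≫ dag (P.inj m) = 𝟙 (𝟙_ C) := by
      refine scalar_ne_zero_iff.1 fun h₀ => hy0 (P.hom_ext_dag_inj fun n => ?_)
      rw [zero_comp]
      by_cases hn : n = m
      · rw [hn, h₀]
      · exact h n hn
    refine P.hom_ext_dag_inj fun n => ?_
    by_cases hn : n = m
    · rw [hn, h', P.inj_dag_self]
    · rw [h n hn, P.inj_dag_of_ne _ _ (Ne.symm hn)]

theorem exists_eq_inj {M : Type v} (P : DaggerBiproduct fun _ : M => 𝟙_ C) {a : 𝟙_ C ⟶ P.pt}
    (ha : IsHomAtom a) : ∃ m, a = P.inj m := by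
  by_contra! h
  refine ha.1 (P.hom_ext_dag_inj fun m => ?_)
  rw [zero_comp]
  exact (scalar_cases _).resolve_right fun h' => h m (ha.eq_of_inner (isHomAtom_inj P m) h')

omit [HasDaggerBiproducts C] in
theorem inj_injective {M : Type v} (P : DaggerBiproduct fun _ : M => 𝟙_ C) :
    Function.Injective P.inj := by
  intro m n h
  by_contra hne
  have h₁ := P.inj_dag_of_ne m n hne
  rw [h, P.inj_dag_self] at h₁
  exact id_unit_ne_zero h₁

theorem exists_isDaggerIso_atomSet (S : RelCat.{v}) :
    ∃ (X : C) (i : atomSet X ⟶ S), IsDaggerIso i := by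
  let P := biprodOf fun _ : carrier S => 𝟙_ C
  refine ⟨P.pt, mk (X := atomSet P.pt) fun x s => x.1 = P.inj s, ?_, ?_⟩
  · refine hom_ext fun x y => ?_
    rw [rel_comp, rel_id]
    simp only [rel_dag, rel_mk]
    constructor
    · rintro ⟨s, hx, hy⟩
      exact Subtype.ext (hx.trans hy.symm)
    · rintro rfl
      obtain ⟨s, hs⟩ := exists_eq_inj P x.2
      exact ⟨s, hs, hs⟩
  · refine hom_ext fun s t => ?_
    rw [rel_comp, rel_id]
    simp only [rel_dag, rel_mk]
    constructor
    · rintro ⟨x, hs, ht⟩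
      exact inj_injective P (hs.symm.trans ht)
    · rintro rfl
      exact ⟨⟨_, isHomAtom_inj P s⟩, rfl, rfl⟩

variable {X Y Z X' Y' : C}

theorem atomMap_surjective (R : atomSet X ⟶ atomSet Y) : ∃ r : X ⟶ Y, atomMap r = R := by
  -- A sum of rank-one morphisms over the pairs in `R`; distinct atoms are orthogonal, so its matrix
  -- is `R`.
  refine ⟨homSum fun p : {p : carrier (atomSet X) × carrier (atomSet Y) // rel R p.1 p.2} =>
    dag p.1.1.1 ≫ p.1.2.1, hom_ext fun x y => ?_⟩
  rw [rel_atomMap, homSum_comp, comp_homSum, scalar_homSum_eq_one]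
  simp only [Category.assoc]
  simp only [← Category.assoc x.1, comp_scalar_eq_one]
  constructor
  · rintro ⟨⟨⟨x', y'⟩, h⟩, hx, hy⟩
    rw [Subtype.ext (x.2.eq_of_inner x'.2 hx), ← Subtype.ext (y'.2.eq_of_inner y.2 hy)]
    exact h
  · intro h
    exact ⟨⟨(x, y), h⟩, inner_self x.2.1, inner_self y.2.1⟩

/-- `E` maps a morphism that preserves atoms to a function. -/
theorem rel_atomMap_iff {f : X ⟶ Y} {x : carrier (atomSet X)} {w : carrier (atomSet Y)}
    (h : x.1 ≫ f = w.1) (y : carrier (atomSet Y)) : rel (atomMap f) x y ↔ w = y := by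
  rw [rel_atomMap_of_isHomAtom _ _ _ (h ▸ w.2), h]
  exact Subtype.ext_iff.symm

variable [SymmetricCategory C] [DaggerCompactClosed C]

theorem atomMap_comp (f : X ⟶ Y) (g : Y ⟶ Z) : atomMap (f ≫ g) = atomMap f ≫ atomMap g := by
  refine hom_ext fun x z => ?_
  rw [rel_comp, rel_atomMap]
  have := comp_eq_one_iff_exists_atom (x.1 ≫ f) (g ≫ dag z.1)
  simp only [Category.assoc] at this ⊢
  rw [this]
  exact ⟨fun ⟨y, hy, h⟩ => ⟨⟨y, hy⟩, h⟩, fun ⟨y, h⟩ => ⟨y.1, y.2, h⟩⟩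

theorem atomMap_injective {f g : X ⟶ Y} (h : atomMap f = atomMap g) : f = g := by
  refine hom_ext_atoms fun x y hx hy => ?_
  have h₁ := rel_atomMap f ⟨x, hx⟩ ⟨y, hy⟩
  rw [h] at h₁
  exact h₁.symm

/-- The tensor product of two atoms. -/
def atomPair (x : carrier (atomSet X)) (y : carrier (atomSet Y)) : carrier (atomSet (X ⊗ Y)) :=
  ⟨tensorState x.1 y.1, x.2.tensorState y.2⟩

theorem rel_atomTensor (p : carrier (atomSet X) × carrier (atomSet Y))
    (z : carrier (atomSet (X ⊗ Y))) :
    rel (atomTensor X Y) p z ↔ atomPair p.1 p.2 = z :=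
  ⟨fun h => Subtype.ext (Eq.symm h), fun h => (congrArg Subtype.val h).symm⟩

theorem rel_atomMap_atomPair (f : X ⟶ X') (g : Y ⟶ Y') (x : carrier (atomSet X))
    (y : carrier (atomSet Y)) (x' : carrier (atomSet X')) (y' : carrier (atomSet Y')) :
    rel (atomMap (f ⊗ₘ g)) (atomPair x y) (atomPair x' y') ↔
      rel (atomMap f) x x' ∧ rel (atomMap g) y y' :=
  tensorState_inner x.1 y.1 f g x'.1 y'.1

theorem atomPair_inj {x x' : carrier (atomSet X)} {y y' : carrier (atomSet Y)} :
    atomPair x y = atomPair x' y' ↔ x = x' ∧ y = y' := by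
  have := rel_atomMap_atomPair (𝟙 X) (𝟙 Y) x y x' y'
  rwa [id_tensorHom_id, atomMap_id, atomMap_id, atomMap_id, rel_id, rel_id, rel_id] at this

theorem exists_atomPair (z : carrier (atomSet (X ⊗ Y))) : ∃ x y, atomPair x y = z := by
  obtain ⟨x, y, hx, hy, h⟩ := z.2.exists_eq_tensorState
  exact ⟨⟨x, hx⟩, ⟨y, hy⟩, Subtype.ext h.symm⟩

theorem isDaggerIso_atomTensor (X Y : C) : IsDaggerIso (atomTensor X Y) := by
  constructor
  · refine hom_ext fun p q => ?_
    rw [rel_comp, rel_id]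
    simp only [rel_dag, rel_atomTensor]
    constructor
    · rintro ⟨z, hp, hq⟩
      exact Prod.ext_iff.2 (atomPair_inj.1 (hp.trans hq.symm))
    · rintro rfl
      exact ⟨_, rfl, rfl⟩
  · refine hom_ext fun z w => ?_
    rw [rel_comp, rel_id]
    simp only [rel_dag, rel_atomTensor]
    constructor
    · rintro ⟨p, hz, hw⟩
      exact hz.symm.trans hw
    · rintro rfl
      obtain ⟨x, y, h⟩ := exists_atomPair z
      exact ⟨(x, y), h, h⟩

theorem atomTensor_natural (f : X ⟶ X') (g : Y ⟶ Y') :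
    (atomMap f ⊗ₘ atomMap g) ≫ atomTensor X' Y' = atomTensor X Y ≫ atomMap (f ⊗ₘ g) := by
  refine hom_ext fun p z => ?_
  obtain ⟨x', y', rfl⟩ := exists_atomPair z
  rw [rel_comp, rel_comp]
  simp only [rel_atomTensor, rel_tensor]
  constructor
  · rintro ⟨q, h, hq⟩
    rw [atomPair_inj] at hq
    refine ⟨_, rfl, (rel_atomMap_atomPair _ _ _ _ _ _).2 ?_⟩
    rwa [← hq.1, ← hq.2]
  · rintro ⟨w, rfl, h⟩
    exact ⟨(x', y'), (rel_atomMap_atomPair _ _ _ _ _ _).1 h, rfl⟩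

theorem atomTensor_natural_left (f : X ⟶ X') (Y : C) :
    atomMap f ▷ atomSet Y ≫ atomTensor X' Y = atomTensor X Y ≫ atomMap (f ▷ Y) := by
  rw [← tensorHom_id, ← tensorHom_id, ← atomTensor_natural, atomMap_id]

theorem atomTensor_natural_right (X : C) (g : Y ⟶ Y') :
    atomSet X ◁ atomMap g ≫ atomTensor X Y' = atomTensor X Y ≫ atomMap (X ◁ g) := by
  rw [← id_tensorHom, ← id_tensorHom, ← atomTensor_natural, atomMap_id]

/-- The associator carries products of atoms to products of atoms, so `E` sends it to a function and
both sides can be compared on triples. -/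
theorem atomTensor_associativity (X Y Z : C) :
    atomTensor X Y ▷ atomSet Z ≫ atomTensor (X ⊗ Y) Z ≫ atomMap (α_ X Y Z).hom =
      (α_ (atomSet X) (atomSet Y) (atomSet Z)).hom ≫ atomSet X ◁ atomTensor Y Z ≫
        atomTensor X (Y ⊗ Z) := by
  refine hom_ext ?_
  rintro ⟨⟨x, y⟩, z⟩ w
  have h := rel_atomMap_iff (f := (α_ X Y Z).hom) (x := atomPair (atomPair x y) z)
    (w := atomPair x (atomPair y z)) (tensorState_associator x.1 y.1 z.1) w
  simp only [rel_comp, exists_carrier_tensor, rel_whiskerRight, rel_whiskerLeft, rel_atomTensor,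
    rel_associator_hom]
  constructor
  · rintro ⟨_, _, ⟨rfl, rfl⟩, _, rfl, h'⟩
    exact ⟨_, _, _, rfl, _, _, ⟨rfl, rfl⟩, h.1 h'⟩
  · rintro ⟨_, _, _, hp, _, _, ⟨rfl, rfl⟩, h'⟩
    obtain ⟨rfl, hp⟩ := Prod.ext_iff.1 hp
    obtain ⟨rfl, rfl⟩ := Prod.ext_iff.1 hp
    exact ⟨_, _, ⟨rfl, rfl⟩, _, rfl, h.2 h'⟩

theorem atomTensor_left_unitality (X : C) :
    (λ_ (atomSet X)).hom =
      atomUnit C ▷ atomSet X ≫ atomTensor (𝟙_ C) X ≫ atomMap (λ_ X).hom := by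
  refine hom_ext ?_
  rintro ⟨p, x⟩ y
  have h := rel_atomMap_iff (f := (λ_ X).hom) (x := atomPair ⟨_, isHomAtom_id_unit⟩ x)
    (w := x) (tensorState_leftUnitor x.1) y
  simp only [rel_comp, exists_carrier_tensor, rel_whiskerRight, rel_atomTensor,
    rel_leftUnitor_hom, rel_atomUnit]
  constructor
  · intro h'
    exact ⟨_, _, ⟨rfl, rfl⟩, _, rfl, h.2 h'⟩
  · rintro ⟨_, _, ⟨rfl, rfl⟩, _, rfl, h'⟩
    exact h.1 h'

theorem atomTensor_right_unitality (X : C) :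
    (ρ_ (atomSet X)).hom =
      atomSet X ◁ atomUnit C ≫ atomTensor X (𝟙_ C) ≫ atomMap (ρ_ X).hom := by
  refine hom_ext ?_
  rintro ⟨x, p⟩ y
  have h := rel_atomMap_iff (f := (ρ_ X).hom) (x := atomPair x ⟨_, isHomAtom_id_unit⟩)
    (w := x) (tensorState_rightUnitor x.1) y
  simp only [rel_comp, exists_carrier_tensor, rel_whiskerLeft, rel_atomTensor,
    rel_rightUnitor_hom, rel_atomUnit]
  constructor
  · intro h'
    exact ⟨_, _, ⟨rfl, rfl⟩, _, rfl, h.2 h'⟩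
  · rintro ⟨_, _, ⟨rfl, rfl⟩, _, rfl, h'⟩
    exact h.1 h'

theorem atomTensor_braided (X Y : C) :
    atomTensor X Y ≫ atomMap (β_ X Y).hom =
      (β_ (atomSet X) (atomSet Y)).hom ≫ atomTensor Y X := by
  refine hom_ext ?_
  rintro ⟨x, y⟩ w
  have h := rel_atomMap_iff (f := (β_ X Y).hom) (x := atomPair x y)
    (w := atomPair y x) (tensorState_braiding x.1 y.1) w
  change (∃ z, rel (atomTensor X Y) (x, y) z ∧ rel (atomMap (β_ X Y).hom) z w) ↔
    ∃ q : carrier (atomSet Y) × carrier (atomSet X),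
      rel (swapIso (atomSet X) (atomSet Y)).hom (x, y) q ∧ rel (atomTensor Y X) q w
  simp only [rel_atomTensor, rel_swapIso_hom]
  constructor
  · rintro ⟨_, rfl, h'⟩
    exact ⟨(y, x), ⟨rfl, rfl⟩, h.1 h'⟩
  · rintro ⟨⟨_, _⟩, ⟨rfl, rfl⟩, h'⟩
    exact ⟨_, rfl, h.2 h'⟩

/-- The isomorphism underlying a dagger isomorphism. -/
@[simps]
def IsDaggerIso.iso {D : Type*} [Category D] [DaggerCategory D] {X Y : D} {f : X ⟶ Y}
    (h : IsDaggerIso f) : X ≅ Y where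
  hom := f
  inv := dag f
  hom_inv_id := h.1
  inv_hom_id := h.2

variable (C) in
/-- The functor of atoms as a strong monoidal functor. -/
def atomFunctorCoreMonoidal (hid : ∀ X : C, atomMap (𝟙 X) = 𝟙 (atomSet X))
    (hcomp : ∀ (X Y Z : C) (f : X ⟶ Y) (g : Y ⟶ Z), atomMap (f ≫ g) = atomMap f ≫ atomMap g) :
    (atomFunctor C hid hcomp).CoreMonoidal where
  εIso := (isDaggerIso_atomUnit (C := C)).iso
  μIso X Y := (isDaggerIso_atomTensor X Y).iso
  μIso_hom_natural_left f Y := atomTensor_natural_left f Y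
  μIso_hom_natural_right X g := atomTensor_natural_right X g
  associativity X Y Z := atomTensor_associativity X Y Z
  left_unitality X := atomTensor_left_unitality X
  right_unitality X := atomTensor_right_unitality X

theorem isDaggerEquivalence_atomFunctor (hid : ∀ X : C, atomMap (𝟙 X) = 𝟙 (atomSet X))
    (hcomp : ∀ (X Y Z : C) (f : X ⟶ Y) (g : Y ⟶ Z), atomMap (f ≫ g) = atomMap f ≫ atomMap g) :
    IsDaggerEquivalence (atomFunctor C hid hcomp) where
  map_dag f := atomMap_dag f
  full := ⟨fun R => atomMap_surjective R⟩
  faithful := ⟨fun h => atomMap_injective h⟩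
  surj S := exists_isDaggerIso_atomSet S

variable (C) in
/-- The functor of atoms as a braided monoidal functor. -/
@[reducible]
def atomFunctorBraided (hid : ∀ X : C, atomMap (𝟙 X) = 𝟙 (atomSet X))
    (hcomp : ∀ (X Y Z : C) (f : X ⟶ Y) (g : Y ⟶ Z), atomMap (f ≫ g) = atomMap f ≫ atomMap g) :
    (atomFunctor C hid hcomp).Braided :=
  letI := (atomFunctorCoreMonoidal C hid hcomp).toMonoidal
  { braided := fun X Y => atomTensor_braided X Y }

end AtomFunctor

/-! ### The converse: relations satisfy the axioms. -/

namespace RelSets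

theorem isDaggerIso_isoOfEquiv {X Y : RelCat.{v}} (e : carrier X ≃ carrier Y) :
    IsDaggerIso (isoOfEquiv e).hom :=
  ⟨(isoOfEquiv e).hom_inv_id, (isoOfEquiv e).inv_hom_id⟩

instance : DaggerSymmetricMonoidal RelCat.{v} where
  dag_tensor _ _ := rfl
  associator_dag _ _ _ := isDaggerIso_isoOfEquiv _
  leftUnitor_dag _ := isDaggerIso_isoOfEquiv _
  rightUnitor_dag _ := isDaggerIso_isoOfEquiv _
  braiding_dag _ _ := isDaggerIso_isoOfEquiv _

/-- Each set is its own dual. -/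
@[reducible]
def selfPairing (X : RelCat.{v}) : ExactPairing X X where
  coevaluation' := mk (X := 𝟙_ RelCat.{v}) (Y := X ⊗ X)
    fun _ (p : carrier X × carrier X) => p.1 = p.2
  evaluation' := mk (X := X ⊗ X) (Y := 𝟙_ RelCat.{v})
    fun (p : carrier X × carrier X) _ => p.1 = p.2
  coevaluation_evaluation' := by
    refine hom_ext ?_
    rintro ⟨x, p⟩ ⟨q, y⟩
    change (∃ s : carrier X × carrier X × carrier X, (x = s.1 ∧ s.2.1 = s.2.2) ∧
      ∃ t : (carrier X × carrier X) × carrier X, (t.1.1, t.1.2, t.2) = s ∧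
        t.1.1 = t.1.2 ∧ t.2 = y) ↔ ∃ z : carrier X, x = z ∧ y = z
    constructor
    · rintro ⟨_, ⟨h₁, h₂⟩, t, rfl, h₃, h₄⟩
      exact ⟨x, rfl, h₄.symm.trans (h₂.symm.trans (h₃.symm.trans h₁.symm))⟩
    · rintro ⟨_, rfl, rfl⟩
      exact ⟨(y, y, y), ⟨rfl, rfl⟩, ((y, y), y), rfl, rfl, rfl⟩
  evaluation_coevaluation' := by
    refine hom_ext ?_
    rintro ⟨p, x⟩ ⟨y, q⟩
    change (∃ s : (carrier X × carrier X) × carrier X, (s.1.1 = s.1.2 ∧ x = s.2) ∧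
      ∃ t : carrier X × carrier X × carrier X, (s.1.1, s.1.2, s.2) = t ∧
        t.1 = y ∧ t.2.1 = t.2.2) ↔ ∃ z : carrier X, x = z ∧ y = z
    constructor
    · rintro ⟨s, ⟨h₁, h₂⟩, _, rfl, h₃, h₄⟩
      exact ⟨x, rfl, h₃.symm.trans (h₁.trans (h₄.trans h₂.symm))⟩
    · rintro ⟨_, rfl, rfl⟩
      exact ⟨((y, y), y), ⟨rfl, rfl⟩, (y, y, y), rfl, rfl, rfl⟩

instance : DaggerCompactClosed RelCat.{v} where
  exists_dual X := by
    refine ⟨X, selfPairing X, hom_ext ?_⟩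
    rintro ⟨x, y⟩ p
    change x = y ↔ ∃ q : carrier X × carrier X, (y, x) = q ∧ q.1 = q.2
    exact ⟨fun h => ⟨_, rfl, h.symm⟩, fun ⟨_, h, h'⟩ => by subst h; exact h'.symm⟩

/-- The inclusion of a summand into a disjoint union. -/
def sigmaInj {M : Type v} (X : M → RelCat.{v}) (m : M) : X m ⟶ of (Σ m, carrier (X m)) :=
  mk (Y := of (Σ m, carrier (X m))) fun x p => (⟨m, x⟩ : Σ m, carrier (X m)) = p

theorem rel_sigmaInj_comp {M : Type v} (X : M → RelCat.{v}) (m : M) {Z : RelCat.{v}}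
    (f : of (Σ m, carrier (X m)) ⟶ Z) (x : carrier (X m)) (z : carrier Z) :
    rel (sigmaInj X m ≫ f) x z ↔ rel f (⟨m, x⟩ : Σ m, carrier (X m)) z :=
  exists_eq_left' (a' := (⟨m, x⟩ : Σ m, carrier (X m))) (p := fun p => rel f p z)

theorem rel_comp_dag_sigmaInj {M : Type v} (X : M → RelCat.{v}) (m : M) {Z : RelCat.{v}}
    (f : Z ⟶ of (Σ m, carrier (X m))) (z : carrier Z) (x : carrier (X m)) :
    rel (f ≫ dag (sigmaInj X m)) z x ↔ rel f z (⟨m, x⟩ : Σ m, carrier (X m)) :=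
  (exists_congr fun _ => and_comm).trans
    (exists_eq_left' (a' := (⟨m, x⟩ : Σ m, carrier (X m))) (p := fun p => rel f z p))

/-- The disjoint union of a family of sets is its dagger biproduct. -/
def sigmaBiproduct {M : Type v} (X : M → RelCat.{v}) : DaggerBiproduct X where
  pt := of (Σ m, carrier (X m))
  inj := sigmaInj X
  isColimit := Cofan.IsColimit.mk _
    (fun s => mk (X := of (Σ m, carrier (X m))) fun p z => rel (s.inj p.1) p.2 z)
    (fun s m => hom_ext fun x z => rel_sigmaInj_comp X m _ x z)
    (fun s f hf => hom_ext fun p z => by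
      rw [rel_mk, ← hf p.1]
      exact (rel_sigmaInj_comp X p.1 f p.2 z).symm)
  isLimit := Fan.IsLimit.mk _
    (fun s => mk (Y := of (Σ m, carrier (X m))) fun z p => rel (s.proj p.1) z p.2)
    (fun s m => hom_ext fun z x => rel_comp_dag_sigmaInj X m _ z x)
    (fun s f hf => hom_ext fun z p => by
      rw [rel_mk, ← hf p.1]
      exact (rel_comp_dag_sigmaInj X p.1 f z p.2).symm)
  inj_dag_self m := hom_ext fun x y => by
    rw [rel_sigmaInj_comp, rel_id]
    exact ⟨fun h => (eq_of_heq (Sigma.mk.inj h).2).symm, fun h => h ▸ rfl⟩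
  inj_dag_of_ne m n hmn := hom_ext fun x y => by
    rw [rel_sigmaInj_comp]
    exact ⟨fun h => hmn (Sigma.mk.inj h).1.symm, False.elim⟩

instance : HasDaggerBiproducts RelCat.{v} where
  exists_biproduct X := ⟨sigmaBiproduct X⟩

theorem ne_zero_iff {X Y : RelCat.{v}} (f : X ⟶ Y) : f ≠ 0 ↔ ∃ x y, rel f x y := by
  constructor
  · intro h
    by_contra! h'
    exact h (hom_ext fun x y => ⟨h' x y, False.elim⟩)
  · rintro ⟨x, y, h⟩ rfl
    exact h

/-- The state given by a subset. -/
def state {X : RelCat.{v}} (s : carrier X → Prop) : 𝟙_ RelCat.{v} ⟶ X :=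
  mk (X := 𝟙_ RelCat.{v}) fun _ x => s x

@[simp] theorem rel_state {X : RelCat.{v}} (s : carrier X → Prop) (p : PUnit.{v + 1})
    (x : carrier X) : rel (state s) p x ↔ s x := Iff.rfl

theorem rel_singleton_comp {X Y : RelCat.{v}} (f : X ⟶ Y) (p : PUnit.{v + 1}) (x : carrier X)
    (y : carrier Y) : rel (state (fun z => x = z) ≫ f) p y ↔ rel f x y :=
  ⟨by rintro ⟨_, rfl, h⟩; exact h, fun h => ⟨_, rfl, h⟩⟩

theorem isSeparator_tensorUnit : IsSeparator (𝟙_ RelCat.{v}) := by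
  rw [isSeparator_def]
  intro X Y f g h
  refine hom_ext fun x y => ?_
  rw [← rel_singleton_comp f PUnit.unit, h, rel_singleton_comp]

/-- If `x` were related to nothing, `f` would not distinguish the singleton of `x` from the empty
state. -/
theorem rel_of_mono {X Y : RelCat.{v}} (f : X ⟶ Y) [Mono f] (x : carrier X) :
    ∃ y, rel f x y := by
  by_contra! h
  have : state (fun z => x = z) = 0 := by
    refine (cancel_mono f).1 (hom_ext fun p y => ?_)
    rw [rel_singleton_comp, zero_comp]
    exact ⟨h y, False.elim⟩
  have h₁ : rel (state fun z => x = z) PUnit.unit x := rfl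
  rw [this] at h₁
  exact h₁

instance simple_tensorUnit : Simple (𝟙_ RelCat.{v}) where
  mono_isIso_iff_nonzero {Y} f _ := by
    constructor
    · rintro _ rfl
      have h : 𝟙 (𝟙_ RelCat.{v}) = 0 := by
        rw [← IsIso.inv_hom_id (0 : Y ⟶ 𝟙_ RelCat.{v}), comp_zero]
      have h₁ : rel (𝟙 (𝟙_ RelCat.{v})) PUnit.unit PUnit.unit := rfl
      rw [h] at h₁
      exact h₁
    · intro h
      obtain ⟨y, p, hy⟩ := (ne_zero_iff f).1 h
      -- A total relation to a one-point set relates everything.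
      have hf : ∀ y p, rel f y p := fun y p => (rel_of_mono f y).elim fun _ h => h
      refine ⟨dag f, hom_ext fun y y' => ⟨fun _ => ?_, fun _ => ⟨p, hf _ _, hf _ _⟩⟩,
        hom_ext fun _ _ => ⟨fun _ => rfl, fun _ => ⟨y, hf _ _, hf _ _⟩⟩⟩
      -- All singletons of `Y` have the same image under the mono `f`, so `Y` has at most one
      -- element.
      have h₁ : state (fun z => y = z) = state (fun z => y' = z) :=
        (cancel_mono f).1 (hom_ext fun q q' => by
          rw [rel_singleton_comp, rel_singleton_comp]
          exact iff_of_true (hf _ _) (hf _ _))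
      have h₂ : rel (state fun z => y' = z) PUnit.unit y := by
        rw [← h₁, rel_state]
      exact h₂.symm

/-- A point `x` outside the subset gives a nonzero effect, the converse of its singleton, that is
zero after `t`. -/
theorem hasZeroCokernel_state_iff {X : RelCat.{v}} (t : 𝟙_ RelCat.{v} ⟶ X) :
    HasZeroCokernel t ↔ ∀ x, rel t PUnit.unit x := by
  rw [hasZeroCokernel_iff]
  constructor
  · intro h x
    by_contra hx
    have h₁ := h _ (dag (state fun z => x = z)) (hom_ext fun p q =>
      ⟨by rintro ⟨_, h, rfl⟩; exact hx h, False.elim⟩)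
    have h₂ : rel (dag (state fun z => x = z)) x PUnit.unit := rfl
    rw [h₁] at h₂
    exact h₂
  · intro h Z q hq
    refine hom_ext fun x z => ⟨fun hxz => ?_, False.elim⟩
    have h₁ : rel (t ≫ q) PUnit.unit z := ⟨x, h x, hxz⟩
    rw [hq] at h₁
    exact h₁

theorem existsUnique_hasZeroCokernel (X : RelCat.{v}) :
    ∃! t : 𝟙_ RelCat.{v} ⟶ X, HasZeroCokernel t := by
  refine ⟨state fun _ => True, (hasZeroCokernel_state_iff _).2 fun _ => trivial, fun t ht => ?_⟩
  exact hom_ext fun p x =>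
    ⟨fun _ => trivial, fun _ => (hasZeroCokernel_state_iff t).1 ht x⟩

/-- A set is the disjoint union of a subset and its complement. -/
noncomputable def sumComplEquiv {X : Type v} (s : X → Prop) :
    (Σ b, carrier (pairFamily (of {x // s x}) (of {x // ¬ s x}) b)) ≃ X :=
  Equiv.ofBijective
    (fun p => match p with
      | ⟨⟨false⟩, x⟩ => x.1
      | ⟨⟨true⟩, x⟩ => x.1) (by
    constructor
    · rintro ⟨⟨_ | _⟩, x⟩ ⟨⟨_ | _⟩, y⟩ h
      · exact congrArg _ (Subtype.ext h)
      · exact absurd x.2 ((show x.1 = y.1 from h) ▸ y.2)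
      · exact absurd y.2 ((show x.1 = y.1 from h) ▸ x.2)
      · exact congrArg _ (Subtype.ext h)
    · intro x
      by_cases hx : s x
      · exact ⟨⟨⟨false⟩, ⟨x, hx⟩⟩, rfl⟩
      · exact ⟨⟨⟨true⟩, ⟨x, hx⟩⟩, rfl⟩)

/-- A state is a subset `s` of `X`, and `X` is the disjoint union of `s` and its complement; the
full state of the first summand has image `s`. -/
theorem unitMorphismsFactor : UnitMorphismsFactor RelCat.{v} := by
  intro X a
  let s : carrier X → Prop := rel a PUnit.unit
  refine ⟨of {x // s x}, of {x // ¬ s x}, sigmaBiproduct _,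
    (isoOfEquiv (X := of (Σ b, carrier (pairFamily (of {x // s x}) (of {x // ¬ s x}) b)))
      (sumComplEquiv s)).hom,
    state fun _ => True, isDaggerIso_isoOfEquiv _,
    (hasZeroCokernel_state_iff _).2 fun _ => trivial, hom_ext fun p x => ?_⟩
  have h := rel_sigmaInj_comp (pairFamily (of {x // s x}) (of {x // ¬ s x})) ⟨false⟩
    (isoOfEquiv (sumComplEquiv s)).hom
  constructor
  · intro hx
    exact ⟨⟨x, hx⟩, trivial, (h ⟨x, hx⟩ x).2 rfl⟩
  · rintro ⟨y, -, hy⟩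
    have h₁ : y.1 = x := (h y x).1 hy
    exact h₁ ▸ y.2

end RelSets

/-- In the first part, the morphisms with zero cokernel in the hypotheses are the `⊤_X`, and `E` is
the functor of atoms; the relations `atomUnit` and `atomTensor` are its monoidal structure. -/
theorem corollary2 :
    (∀ (C : Type u) [Category.{v} C] [DaggerCategory C] [MonoidalCategory C]
        [SymmetricCategory C] [DaggerCompactClosed C] [HasZeroMorphisms C]
        [HasDaggerBiproducts C],
      Simple (𝟙_ C) → IsSeparator (𝟙_ C) →
      (∀ X : C, ∃! t : 𝟙_ C ⟶ X, HasZeroCokernel t) →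
      UnitMorphismsFactor C →
      ∃ (hid : ∀ X : C, atomMap (𝟙 X) = 𝟙 (atomSet X))
        (hcomp : ∀ (X Y Z : C) (f : X ⟶ Y) (g : Y ⟶ Z),
          atomMap (f ≫ g) = atomMap f ≫ atomMap g),
        IsDaggerEquivalence (atomFunctor C hid hcomp) ∧
        ∃ _ : (atomFunctor C hid hcomp).Braided,
          Functor.LaxMonoidal.ε (atomFunctor C hid hcomp) = atomUnit C ∧
          (∀ X Y : C, Functor.LaxMonoidal.μ (atomFunctor C hid hcomp) X Y = atomTensor X Y) ∧
          IsDaggerIso (Functor.LaxMonoidal.ε (atomFunctor C hid hcomp)) ∧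
          (∀ X Y : C, IsDaggerIso (Functor.LaxMonoidal.μ (atomFunctor C hid hcomp) X Y))) ∧
    (DaggerCompactClosed RelCat.{v} ∧ HasDaggerBiproducts RelCat.{v} ∧
      Simple (𝟙_ RelCat.{v}) ∧ IsSeparator (𝟙_ RelCat.{v}) ∧
      (∀ X : RelCat.{v}, ∃! t : 𝟙_ RelCat.{v} ⟶ X, HasZeroCokernel t) ∧
      UnitMorphismsFactor RelCat.{v}) := by
  refine ⟨?_, inferInstance, inferInstance, RelSets.simple_tensorUnit,
    RelSets.isSeparator_tensorUnit, RelSets.existsUnique_hasZeroCokernel,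
    RelSets.unitMorphismsFactor⟩
  intro C _ _ _ _ _ _ _ hsimple hsep htop hfac
  have : RelAxioms C := ⟨hsimple, hsep, htop, hfac⟩
  exact ⟨atomMap_id, fun _ _ _ => atomMap_comp, isDaggerEquivalence_atomFunctor _ _,
    atomFunctorBraided C _ _, rfl, fun _ _ => rfl, isDaggerIso_atomUnit,
    isDaggerIso_atomTensor⟩
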